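/- **Streaming SVRG-based solver with no initial error.** *Setting.* Let $d\ge 2$ and let $\mathcal D$ be a probability distribution on $\mathbb R^d$ with $\mathbb E_{a\sim\mathcal D}\|a\|_2^4<\infty$. Put $\Sigma=\mathbb E_{a\sim\mathcal D}[aa^\top]$ with eigenvalues $\lambda_1\ge\lambda_2\ge\dots\ge\lambda_d$, $\mathrm{gap}=\frac{\lambda_1-\lambda_2}{\lambda_1}$ (assumed positive), and $v(\mathcal D)=\|\mathbb E_{a\sim\mathcal D}[(aa^\top)^2]\|_2/\|\Sigma\|_2^2$. Let $(1+\frac{\mathrm{gap}}{150})\lambda_1\le\lambda\le(1+\frac{\mathrm{gap}}{100})\lambda_1$, $B=\lambda I-\Sigma$, let $b\in\mathbb R^d$ be a unit vector, $x^*=B^{-1}b$, $\|x\|_B=\sqrt{x^\top Bx}$, and let $\lambda_1(B^{-1})$ be the largest eigenvalue of $B^{-1}$. Put $\psi_a(x)=\frac12x^\top(\lambda I-aa^\top)x-b^\top x$, $\mu=\lambda-\lambda_1$ and $\overline S=\lambda+\frac{v(\mathcal D)\lambda_1^2}{\lambda-\lambda_1}$. *Streaming SVRG step.* For $x_0\in\mathbb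 R^d$, $\eta>0$ and integers $k,m\ge1$, the random point $\mathrm{ssvrg\_iter}(x_0,\eta,k,m)$ is obtained as follows. Draw $k$ samples $a_1,\dots,a_k$ from $\mathcal D$ and set $g=\frac1k\sum_{i=1}^k\psi_{a_i}$; draw $\tilde m$ uniformly from $\{1,\dots,m\}$, then $\tilde m$ further samples $\tilde a_0,\dots,\tilde a_{\tilde m-1}$ from $\mathcal D$ (all draws independent); for $t=0,\dots,\tilde m-1$ set $$x_{t+1}=x_t-\frac{\eta}{\overline S}\bigl(\nabla\psi_{\tilde a_t}(x_t)-\nabla\psi_{\tilde a_t}(x_0)+\nabla g(x_0)\bigr);$$ return $x_{\tilde m}$. The step uses $k+\tilde m$ samples. *Algorithm.* For $c_2,\gamma\in(0,1)$ and $c_3\in(0,1)$, start from $x^{(0)}=0$ and for $i=0,1,\dots,N-1$, where $N=\lceil\log_2(1/c_3)\rceil$, set $x^{(i+1)}=\mathrm{ssvrg\_iter}(x^{(i)},\eta,k_i,m)$ using fresh samples and randomness in every round, with $$\eta=\frac{c_2}{8},\qquad m=\left\lceil\frac{\overline S}{\mu c_2^2}\right\rceil,\qquad k_i=\max\left\{\left\lceil\frac{\overline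 S}{\mu c_2}\right\rceil,\left\lceil\frac{v(\mathcal D)\lambda_1^2}{(\lambda-\lambda_1)^2\,\gamma 2^{-i}}\right\rceil\right\}.$$ Return $x=x^{(N)}$. *Claim.* There are absolute constants $c_2,\gamma\in(0,1)$ and $C>0$ such that, for all $d,\mathcal D,\lambda,b$ as above and every $c_3\in(0,1)$, the algorithm returns $x$ with $\|x-x^*\|_B^2$ integrable and $$\mathbb E\,\|x-x^*\|_B^2\le 10\,c_3\,\lambda_1(B^{-1}),$$ and the total number of samples it draws from $\mathcal D$ is, almost surely, at most $C\,\dfrac{v(\mathcal D)}{\mathrm{gap}^2\,c_3}$. -/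

import Mathlib

open MeasureTheory ProbabilityTheory Matrix

namespace StreamingSVRG

noncomputable section

/-- `ℝ^d` with the Euclidean norm. -/
abbrev Vec (d : ℕ) := EuclideanSpace ℝ (Fin d)

/-- The rank-one matrix `a aᵀ`. -/
def outer {d : ℕ} (a : Vec d) : Matrix (Fin d) (Fin d) ℝ :=
  vecMulVec a.ofLp a.ofLp

/-- `Σ = E_{a ∼ D} [a aᵀ]`, entrywise. -/
def secondMoment {d : ℕ} (D : Measure (Vec d)) : Matrix (Fin d) (Fin d) ℝ :=
  Matrix.of fun i j => ∫ a, outer a i j ∂D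

/-- `E_{a ∼ D} [(a aᵀ)²]`, entrywise. -/
def fourthMoment {d : ℕ} (D : Measure (Vec d)) : Matrix (Fin d) (Fin d) ℝ :=
  Matrix.of fun i j => ∫ a, (outer a * outer a) i j ∂D

/-- The spectral norm `‖M‖₂`: the operator norm for the Euclidean norm. -/
def specNorm {d : ℕ} (M : Matrix (Fin d) (Fin d) ℝ) : ℝ :=
  ‖Matrix.toEuclideanCLM (n := Fin d) (𝕜 := ℝ) M‖

/-- The eigenvalues of a symmetric matrix in decreasing order, with multiplicity:
`eigenvalue M 1 ≥ eigenvalue M 2 ≥ … ≥ eigenvalue M d`.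
(The value is `0` if `M` is not symmetric or the index is not in `{1, …, d}`.) -/
def eigenvalue {d : ℕ} (M : Matrix (Fin d) (Fin d) ℝ) (i : ℕ) : ℝ :=
  if h : M.IsHermitian ∧ 1 ≤ i ∧ i ≤ d then
    h.1.eigenvalues₀ ⟨i - 1, by rw [Fintype.card_fin]; omega⟩
  else 0

/-- `‖x‖_M = √(xᵀ M x)`. -/
def matNorm {d : ℕ} (M : Matrix (Fin d) (Fin d) ℝ) (x : Vec d) : ℝ :=
  √(x.ofLp ⬝ᵥ (M *ᵥ x.ofLp))

/-- `λ₁ = λ₁(Σ)`. -/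
def topEig {d : ℕ} (D : Measure (Vec d)) : ℝ := eigenvalue (secondMoment D) 1

/-- `gap = (λ₁ - λ₂) / λ₁`. -/
def gap {d : ℕ} (D : Measure (Vec d)) : ℝ :=
  (eigenvalue (secondMoment D) 1 - eigenvalue (secondMoment D) 2) /
    eigenvalue (secondMoment D) 1

/-- `v(D) = ‖E[(a aᵀ)²]‖₂ / ‖E[a aᵀ]‖₂²`. -/
def nvar {d : ℕ} (D : Measure (Vec d)) : ℝ :=
  specNorm (fourthMoment D) / specNorm (secondMoment D) ^ 2

/-- `B = λ I - Σ`. -/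
def shifted {d : ℕ} (D : Measure (Vec d)) (lam : ℝ) : Matrix (Fin d) (Fin d) ℝ :=
  lam • (1 : Matrix (Fin d) (Fin d) ℝ) - secondMoment D

/-- The solution `x* = B⁻¹ b` of `B x = b`. -/
def solution {d : ℕ} (D : Measure (Vec d)) (lam : ℝ) (b : Vec d) : Vec d :=
  WithLp.toLp 2 ((shifted D lam)⁻¹ *ᵥ b.ofLp)

/-- `ψ_a(x) = ½ xᵀ (λ I - a aᵀ) x - bᵀ x`. -/
def psi {d : ℕ} (lam : ℝ) (b a x : Vec d) : ℝ :=
  1 / 2 * (x.ofLp ⬝ᵥ ((lam • (1 : Matrix (Fin d) (Fin d) ℝ) - outer a) *ᵥ x.ofLp))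
    - b.ofLp ⬝ᵥ x.ofLp

/-- `g = (1/k) ∑_{i < k} ψ_{s i}`, the average over the first `k` samples of `s`. -/
def batchObjective {d : ℕ} (lam : ℝ) (b : Vec d) (k : ℕ) (s : ℕ → Vec d) (x : Vec d) : ℝ :=
  1 / (k : ℝ) * ∑ i ∈ Finset.range k, psi lam b (s i) x

/-- The inner iterates `x_t` of a streaming SVRG step started at `x₀` with step size `η / L`:
the samples `s 0, …, s (k - 1)` form `g`, and the update from `x_t` to `x_{t+1}` uses the
fresh sample `s (k + t)`. -/
def ssvrgInner {d : ℕ} (lam : ℝ) (b : Vec d) (L η : ℝ) (k : ℕ) (s : ℕ → Vec d) (x₀ : Vec d) :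
    ℕ → Vec d
  | 0 => x₀
  | t + 1 =>
      let x := ssvrgInner lam b L η k s x₀ t
      x - (η / L) • (gradient (psi lam b (s (k + t))) x - gradient (psi lam b (s (k + t))) x₀
        + gradient (batchObjective lam b k s) x₀)

/-- The state of the streaming algorithm: the current point, and how many samples of the stream
have been read so far. -/
structure State (d : ℕ) where
  point : Vec d
  used : ℕ

/-- One streaming SVRG step `ssvrg_iter` on the stream `s`, where `mt` is the value drawn for
the number of inner iterations: it reads the next `k + mt` unread samples of the stream. -/
def ssvrgStep {d : ℕ} (lam : ℝ) (b : Vec d) (L η : ℝ) (k mt : ℕ) (s : ℕ → Vec d)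
    (S : State d) : State d where
  point := ssvrgInner lam b L η k (fun n => s (S.used + n)) S.point mt
  used := S.used + (k + mt)

/-- `μ = λ - λ₁`. -/
def mu {d : ℕ} (D : Measure (Vec d)) (lam : ℝ) : ℝ := lam - topEig D

/-- `S̄ = λ + v(D) λ₁² / (λ - λ₁)`. -/
def Sbar {d : ℕ} (D : Measure (Vec d)) (lam : ℝ) : ℝ :=
  lam + nvar D * topEig D ^ 2 / mu D lam

/-- `m = ⌈S̄ / (μ c₂²)⌉`. -/
def innerLength {d : ℕ} (D : Measure (Vec d)) (lam c₂ : ℝ) : ℕ :=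
  ⌈Sbar D lam / (mu D lam * c₂ ^ 2)⌉₊

/-- `k = max {⌈S̄ / (μ c₂)⌉, ⌈v(D) λ₁² / ((λ - λ₁)² c₃)⌉}`. -/
def batchSize {d : ℕ} (D : Measure (Vec d)) (lam c₂ c₃ : ℝ) : ℕ :=
  max ⌈Sbar D lam / (mu D lam * c₂)⌉₊ ⌈nvar D * topEig D ^ 2 / (mu D lam ^ 2 * c₃)⌉₊

/-- The iterated solver after a number of rounds, on the stream `s` and with `mt i` the number
of inner iterations drawn in round `i`. It starts at `0` with nothing read; round `i` is the
streaming SVRG step with `η = c₂ / 8`, `L = S̄` and the batch size for the accuracy parameter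
`γ / 2^i`, which is halved from one round to the next. -/
def iteratedSolver {d : ℕ} (D : Measure (Vec d)) (lam : ℝ) (b : Vec d) (c₂ γ : ℝ)
    (s : ℕ → Vec d) (mt : ℕ → ℕ) : ℕ → State d
  | 0 => ⟨0, 0⟩
  | i + 1 =>
      ssvrgStep lam b (Sbar D lam) (c₂ / 8) (batchSize D lam c₂ (γ / 2 ^ i)) (mt i) s
        (iteratedSolver D lam b c₂ γ s mt i)

theorem secondMoment_isHermitian {d : ℕ} (D : Measure (Vec d)) :
    (secondMoment D).IsHermitian := by
  ext i j
  simp [secondMoment, outer, vecMulVec_apply, mul_comm]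

theorem shifted_isHermitian {d : ℕ} (D : Measure (Vec d)) (lam : ℝ) :
    (shifted D lam).IsHermitian := by
  refine Matrix.IsHermitian.sub ?_ (secondMoment_isHermitian D)
  simp [Matrix.IsHermitian]

/-- The matrix whose largest eigenvalue is `λ₁(B⁻¹)` is symmetric. -/
theorem shifted_inv_isHermitian {d : ℕ} (D : Measure (Vec d)) (lam : ℝ) :
    ((shifted D lam)⁻¹).IsHermitian :=
  (shifted_isHermitian D lam).inv

end

end StreamingSVRG

/-! Write `E(x) = xᵀBx`, `V = ‖E[(aaᵀ)²]‖₂`, `Λ = λ₁(B⁻¹)`, and measure errors from `x*`. Since `V =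
v(D) λ₁²`, one has `S̄ = λ + V/μ`.

One inner step. The error obeys `e ↦ e - h G` with `G = (λI - aaᵀ)e - (Σ - aaᵀ)e₀ + ξ`, where `ξ` is
the error of the batch gradient at `x₀`. The fresh sample gives `G` the mean `Be + ξ`. Individual
`ψ_a` need not be convex: `B ⪰ μI` alone bounds the second moments of the first two terms by `S̄
E(e)` and `S̄ E(e₀)`, and Young's inequality handles `⟨ξ, e⟩`. Thus `‖e‖²` drops in expectation by
about `h E(e)`, up to multiples of `‖ξ‖²` and `E(e₀)` (`lintegral_norm_sub_stochGrad_sq_le`).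

One round. Telescoping bounds the average of `E(e_t)`, which is what the uniform number of inner
steps samples. The batch contributes `E‖ξ‖² ≤ (V/k) E‖x₀‖²`; this scales with `x₀` rather than with
its error, so it leaves a floor proportional to `Λ`. With batch accuracy `γ/2^i` the expected
energies satisfy `Q_{i+1} ≤ Q_i/4 + 2^{-i}Λ/4` (`sum_lintegral_energy_round_le`).

All rounds. The start `0` has `E(x*) = bᵀB⁻¹b ≤ Λ`, hence `Q_i ≤ 2^{-i}Λ`, and `2^{-N} ≤ c₃`. Round
`i` costs `O(2^i v/gap²)` samples, a geometric sum of order `v/(gap² c₃)`.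

Randomness. The position of a sample in the stream depends on the drawn inner lengths. Those are
independent of the stream, so they are frozen first, making all positions deterministic, and
averaged afterwards. Extended nonnegative integrals postpone integrability to the end. -/

namespace StreamingSVRG

/-! ### Independence and integration along a sequence of draws. -/

section Probability

/-- Extend a finite prefix of a sequence by a default value. -/
def extendPrefix {V : Type*} [Inhabited V] (n : ℕ) (r : Finset.range n → V) (j : ℕ) : V :=
  if h : j ∈ Finset.range n then r ⟨j, h⟩ else default

theorem dependsOn_extendPrefix {V E : Type*} [Inhabited V] {n : ℕ} {X : (ℕ → V) → E}
    (hX : DependsOn X (Set.Iio n)) (s : ℕ → V) :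
    X (extendPrefix n fun j => s j) = X s :=
  hX fun j hj => by simp_all [extendPrefix]

variable {Ω V E : Type*} [MeasurableSpace Ω] [MeasurableSpace V] [MeasurableSpace E]

/-- Integrating out the second of two independent random variables first. -/
theorem lintegral_of_indepFun {P : Measure Ω} [IsProbabilityMeasure P] {X : Ω → E} {Y : Ω → V}
    (hX : Measurable X) (hY : Measurable Y) (h : IndepFun X Y P)
    {f : E × V → ENNReal} (hf : Measurable f) :
    ∫⁻ ω, f (X ω, Y ω) ∂P = ∫⁻ ω, ∫⁻ y, f (X ω, y) ∂(P.map Y) ∂P := by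
  have := Measure.isProbabilityMeasure_map hY.aemeasurable (μ := P)
  rw [← lintegral_map (f := f) (g := fun ω => (X ω, Y ω)) hf (hX.prodMk hY),
    (indepFun_iff_map_prod_eq_prod_map_map hX.aemeasurable hY.aemeasurable).1 h,
    lintegral_prod _ hf.aemeasurable, lintegral_map hf.lintegral_prod_right' hX]

theorem measurable_extendPrefix [Inhabited V] (n : ℕ) :
    Measurable (extendPrefix (V := V) n) := by
  refine measurable_pi_lambda _ fun j => ?_
  by_cases h : j ∈ Finset.range n
  · simpa [extendPrefix, h] using measurable_pi_apply _
  · simp [extendPrefix, h]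

/-- A function of the first `n` terms of an independent sequence is independent of term `n`. -/
theorem indepFun_of_dependsOn [Inhabited V] {P : Measure Ω} {Y : ℕ → Ω → V}
    (hY : ∀ n, Measurable (Y n)) (hind : iIndepFun Y P) {n : ℕ} {X : (ℕ → V) → E}
    (hX : Measurable X) (hdep : DependsOn X (Set.Iio n)) :
    IndepFun (fun ω => X fun j => Y j ω) (Y n) P := by
  have h := hind.indepFun_finset (Finset.range n) {n} (by simp) hY
  have h2 := h.comp (hX.comp (measurable_extendPrefix n))
    (measurable_pi_apply (⟨n, by simp⟩ : ({n} : Finset ℕ)))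
  rwa [show (X ∘ extendPrefix n) ∘ (fun ω (i : Finset.range n) => Y i ω) =
    fun ω => X fun j => Y j ω from funext fun ω => dependsOn_extendPrefix hdep fun j => Y j ω] at h2

/-- The map factors through a finite prefix of naturals, a countable discrete space on which every
function is measurable. -/
theorem measurable_of_dependsOn_nat {n : ℕ} {X : (ℕ → ℕ) → E}
    (hdep : DependsOn X (Set.Iio n)) : Measurable X := by
  have : X = (fun r : Finset.range n → ℕ => X (extendPrefix n r)) ∘
      fun (s : ℕ → ℕ) (j : Finset.range n) => s j := by
    ext s
    exact (dependsOn_extendPrefix hdep s).symm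
  rw [this]
  exact (measurable_of_countable _).comp (measurable_pi_lambda _ fun j => measurable_pi_apply _)

/-- This plays the role of conditioning on the past: a quantity built from earlier terms is held
fixed while the next term is averaged. -/
theorem lintegral_prefix_next [Inhabited V] {P : Measure Ω} [IsProbabilityMeasure P]
    {Y : ℕ → Ω → V} (hY : ∀ n, Measurable (Y n)) (hind : iIndepFun Y P) {n : ℕ}
    {X : (ℕ → V) → E} (hX : Measurable X) (hdep : DependsOn X (Set.Iio n))
    {f : E × V → ENNReal} (hf : Measurable f) :
    ∫⁻ ω, f (X fun j => Y j ω, Y n ω) ∂P =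
      ∫⁻ ω, ∫⁻ y, f (X fun j => Y j ω, y) ∂(P.map (Y n)) ∂P :=
  lintegral_of_indepFun (hX.comp (measurable_pi_lambda _ hY)) (hY n)
    (indepFun_of_dependsOn hY hind hX hdep) hf

theorem lintegral_uniformOn_Icc (m : ℕ) (f : ℕ → ENNReal) :
    ∫⁻ j, f j ∂(uniformOn (Set.Icc 1 m)) = (m : ENNReal)⁻¹ * ∑ j ∈ Finset.Icc 1 m, f j := by
  have hc : (Measure.count (Set.Icc 1 m) : ENNReal) = m := by
    rw [← Finset.coe_Icc, Measure.count_apply_finset]; simp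
  rw [uniformOn, ProbabilityTheory.cond, lintegral_smul_measure, hc, smul_eq_mul,
    ← Finset.coe_Icc, lintegral_finset]
  simp

end Probability

/-! ### Quadratic forms and eigenvalues of symmetric matrices. -/

section Spectral

variable {d : ℕ}

theorem quadForm_eq_sum {M : Matrix (Fin d) (Fin d) ℝ} (hM : M.IsHermitian) (x : Vec d) :
    inner ℝ x (toEuclideanCLM (n := Fin d) (𝕜 := ℝ) M x) =
      ∑ i, hM.eigenvalues i * (inner ℝ (hM.eigenvectorBasis i) x) ^ 2 ∧
    ‖toEuclideanCLM (n := Fin d) (𝕜 := ℝ) M x‖ ^ 2 =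
      ∑ i, hM.eigenvalues i ^ 2 * (inner ℝ (hM.eigenvectorBasis i) x) ^ 2 := by
  have key : ∀ i, inner ℝ (hM.eigenvectorBasis i) (toEuclideanCLM (n := Fin d) (𝕜 := ℝ) M x) =
      hM.eigenvalues i * inner ℝ (hM.eigenvectorBasis i) x := by
    intro i
    rw [inner_toEuclideanCLM, dotProduct_mulVec, ← mulVec_transpose,
      show Mᵀ = M by rw [← conjTranspose_eq_transpose_of_trivial, hM.eq],
      hM.mulVec_eigenvectorBasis, smul_dotProduct, EuclideanSpace.inner_eq_star_dotProduct,
      dotProduct_comm]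
    simp
  constructor
  · rw [← hM.eigenvectorBasis.sum_inner_mul_inner]
    refine Finset.sum_congr rfl fun i _ => ?_
    rw [key, real_inner_comm]; ring
  · rw [← hM.eigenvectorBasis.sum_sq_norm_inner_right]
    refine Finset.sum_congr rfl fun i _ => ?_
    rw [key, Real.norm_eq_abs, sq_abs]; ring

theorem exists_unit_eigenvector {M : Matrix (Fin d) (Fin d) ℝ} (hM : M.IsHermitian) {i : ℕ}
    (h1 : 1 ≤ i) (hd : i ≤ d) :
    ∃ u : Vec d, ‖u‖ = 1 ∧ toEuclideanCLM (n := Fin d) (𝕜 := ℝ) M u = eigenvalue M i • u := by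
  -- `eigenvalue` uses the sorted list `eigenvalues₀`, whereas the eigenbasis is indexed through
  -- `eigenvalues`; `e` translates between the two indexings.
  set k : Fin (Fintype.card (Fin d)) := ⟨i - 1, by rw [Fintype.card_fin]; omega⟩
  set e := (Fintype.equivOfCardEq (Fintype.card_fin _) : Fin (Fintype.card (Fin d)) ≃ Fin d)
  refine ⟨hM.eigenvectorBasis (e k), hM.eigenvectorBasis.norm_eq_one _, ?_⟩
  have hE : eigenvalue M i = hM.eigenvalues (e k) := by
    rw [eigenvalue, dif_pos ⟨hM, h1, hd⟩]
    simp [Matrix.IsHermitian.eigenvalues, e, k]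
  apply (WithLp.ofLp_injective 2)
  rw [ofLp_toEuclideanCLM, hM.mulVec_eigenvectorBasis, hE]
  rfl

theorem eigenvalues_le_eigenvalue_one {M : Matrix (Fin d) (Fin d) ℝ} (hM : M.IsHermitian)
    (hd : 1 ≤ d) (i : Fin d) : hM.eigenvalues i ≤ eigenvalue M 1 := by
  rw [eigenvalue, dif_pos ⟨hM, le_rfl, hd⟩]
  exact hM.eigenvalues₀_antitone (Fin.mk_le_of_le_val (by simp))

theorem quadForm_le_eigenvalue_one {M : Matrix (Fin d) (Fin d) ℝ} (hM : M.IsHermitian)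
    (hd : 1 ≤ d) (x : Vec d) :
    inner ℝ x (toEuclideanCLM (n := Fin d) (𝕜 := ℝ) M x) ≤ eigenvalue M 1 * ‖x‖ ^ 2 := by
  rw [(quadForm_eq_sum hM x).1, ← hM.eigenvectorBasis.sum_sq_norm_inner_right, Finset.mul_sum]
  refine Finset.sum_le_sum fun i _ => ?_
  rw [Real.norm_eq_abs, sq_abs]
  exact mul_le_mul_of_nonneg_right (eigenvalues_le_eigenvalue_one hM hd i) (sq_nonneg _)

theorem eigenvalue_nonneg {M : Matrix (Fin d) (Fin d) ℝ} (hM : M.IsHermitian)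
    (hpos : ∀ x : Vec d, 0 ≤ inner ℝ x (toEuclideanCLM (n := Fin d) (𝕜 := ℝ) M x)) {i : ℕ}
    (h1 : 1 ≤ i) (hd : i ≤ d) : 0 ≤ eigenvalue M i := by
  obtain ⟨u, hu, hMu⟩ := exists_unit_eigenvector hM h1 hd
  have := hpos u
  rwa [hMu, real_inner_smul_right, real_inner_self_eq_norm_sq, hu, one_pow, mul_one] at this

theorem specNorm_eq_eigenvalue_one {M : Matrix (Fin d) (Fin d) ℝ} (hM : M.IsHermitian)
    (hd : 1 ≤ d) (hpos : ∀ x : Vec d, 0 ≤ inner ℝ x (toEuclideanCLM (n := Fin d) (𝕜 := ℝ) M x)) :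
    specNorm M = eigenvalue M 1 := by
  have h0 := eigenvalue_nonneg hM hpos le_rfl hd
  apply le_antisymm
  · refine ContinuousLinearMap.opNorm_le_bound _ h0 fun x => ?_
    refine abs_le_of_sq_le_sq' ?_ (by positivity) |>.2
    rw [(quadForm_eq_sum hM x).2, mul_pow, ← hM.eigenvectorBasis.sum_sq_norm_inner_right,
      Finset.mul_sum]
    refine Finset.sum_le_sum fun i _ => ?_
    rw [Real.norm_eq_abs, sq_abs]
    refine mul_le_mul_of_nonneg_right (pow_le_pow_left₀ ?_
      (eigenvalues_le_eigenvalue_one hM hd i) 2) (sq_nonneg _)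
    -- Squaring `λᵢ ≤ λ₁` requires `0 ≤ λᵢ`, obtained by testing positivity on the eigenvector.
    have hu := hpos (hM.eigenvectorBasis i)
    rw [inner_toEuclideanCLM, hM.mulVec_eigenvectorBasis] at hu
    have h2 := hM.eigenvectorBasis.norm_eq_one i
    have h3 := real_inner_self_eq_norm_sq (hM.eigenvectorBasis i)
    rw [h2, EuclideanSpace.inner_eq_star_dotProduct] at h3
    simp only [star_trivial] at h3
    simpa [dotProduct_smul, h3] using hu
  · obtain ⟨u, hu, hMu⟩ := exists_unit_eigenvector hM le_rfl hd
    have := (toEuclideanCLM (n := Fin d) (𝕜 := ℝ) M).le_opNorm u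
    rwa [hMu, norm_smul, hu, mul_one, mul_one, Real.norm_of_nonneg h0] at this

end Spectral

/-! ### Second and fourth moments of the sample distribution. -/

section Moments

variable {d : ℕ}

theorem inner_toEuclideanCLM_integral {D : Measure (Vec d)}
    {M : Vec d → Matrix (Fin d) (Fin d) ℝ} (hM : ∀ i j, Integrable (fun a => M a i j) D)
    (x z : Vec d) :
    inner ℝ x (toEuclideanCLM (n := Fin d) (𝕜 := ℝ) (Matrix.of fun i j => ∫ a, M a i j ∂D) z) =
      ∫ a, inner ℝ x (toEuclideanCLM (n := Fin d) (𝕜 := ℝ) (M a) z) ∂D := by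
  simp only [inner_toEuclideanCLM, dotProduct, mulVec, of_apply]
  have h2 : ∀ i j, Integrable (fun a => M a i j * z.ofLp j) D := fun i j => (hM i j).mul_const _
  rw [integral_finsetSum _ fun i _ => (integrable_finsetSum _ fun j _ => h2 i j).const_mul _]
  refine Finset.sum_congr rfl fun i _ => ?_
  rw [integral_const_mul, integral_finsetSum _ fun j _ => h2 i j]
  simp only [integral_mul_const]

theorem outer_toEuclideanCLM (a x : Vec d) :
    toEuclideanCLM (n := Fin d) (𝕜 := ℝ) (outer a) x = (inner ℝ a x : ℝ) • a := by
  apply (WithLp.ofLp_injective 2)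
  ext i
  simp only [ofLp_toEuclideanCLM, outer, vecMulVec_mulVec, WithLp.ofLp_smul,
    EuclideanSpace.inner_eq_star_dotProduct, star_trivial, dotProduct_comm x.ofLp]
  simp [mul_comm]

theorem norm_sq_le_one_add_pow_four (a : Vec d) : ‖a‖ ^ 2 ≤ 1 + ‖a‖ ^ 4 := by
  nlinarith [sq_nonneg (‖a‖ ^ 2 - 1)]

variable {D : Measure (Vec d)}

theorem integrable_inner_mul_inner [IsProbabilityMeasure D]
    (h4 : Integrable (fun a => ‖a‖ ^ 4) D) (x z : Vec d) :
    Integrable (fun a => inner ℝ a x * inner ℝ a z) D := by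
  refine Integrable.mono' (((integrable_const 1).add h4).mul_const (‖x‖ * ‖z‖))
    (by fun_prop) (ae_of_all _ fun a => ?_)
  rw [norm_mul]
  calc ‖inner ℝ a x‖ * ‖inner ℝ a z‖ ≤ (‖a‖ * ‖x‖) * (‖a‖ * ‖z‖) := by
        gcongr <;> exact norm_inner_le_norm _ _
    _ = ‖a‖ ^ 2 * (‖x‖ * ‖z‖) := by ring
    _ ≤ _ := by gcongr; exact norm_sq_le_one_add_pow_four a

theorem integrable_inner_mul_inner_mul_norm_sq
    (h4 : Integrable (fun a => ‖a‖ ^ 4) D) (x z : Vec d) :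
    Integrable (fun a => inner ℝ a x * inner ℝ a z * ‖a‖ ^ 2) D := by
  refine Integrable.mono' (h4.mul_const (‖x‖ * ‖z‖)) (by fun_prop) (ae_of_all _ fun a => ?_)
  rw [norm_mul, norm_mul]
  calc ‖inner ℝ a x‖ * ‖inner ℝ a z‖ * ‖‖a‖ ^ 2‖ ≤ (‖a‖ * ‖x‖) * (‖a‖ * ‖z‖) * ‖a‖ ^ 2 := by
        gcongr
        · exact norm_inner_le_norm _ _
        · exact norm_inner_le_norm _ _
        · simp
    _ = _ := by ring

theorem apply_eq_inner_single (M : Matrix (Fin d) (Fin d) ℝ) (i j : Fin d) :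
    M i j = inner ℝ (EuclideanSpace.single i (1 : ℝ))
      (toEuclideanCLM (n := Fin d) (𝕜 := ℝ) M (EuclideanSpace.single j 1)) := by
  simp [inner_toEuclideanCLM]

theorem inner_outer (a x z : Vec d) :
    inner ℝ x (toEuclideanCLM (n := Fin d) (𝕜 := ℝ) (outer a) z) = inner ℝ a x * inner ℝ a z := by
  rw [outer_toEuclideanCLM, real_inner_smul_right, real_inner_comm x a, mul_comm]

theorem inner_outer_mul_outer (a x z : Vec d) :
    inner ℝ x (toEuclideanCLM (n := Fin d) (𝕜 := ℝ) (outer a * outer a) z) =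
      inner ℝ a x * inner ℝ a z * ‖a‖ ^ 2 := by
  rw [map_mul, mul_apply_eq_comp, inner_outer, outer_toEuclideanCLM,
    real_inner_smul_right, real_inner_self_eq_norm_sq]
  ring

/-- `Σ` as an operator. -/
noncomputable def secondMomentCLM (D : Measure (Vec d)) : Vec d →L[ℝ] Vec d :=
  toEuclideanCLM (n := Fin d) (𝕜 := ℝ) (secondMoment D)

theorem inner_secondMomentCLM [IsProbabilityMeasure D] (h4 : Integrable (fun a => ‖a‖ ^ 4) D)
    (x z : Vec d) :
    inner ℝ x (secondMomentCLM D z) = ∫ a, inner ℝ a x * inner ℝ a z ∂D := by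
  rw [secondMomentCLM, secondMoment, inner_toEuclideanCLM_integral]
  · simp only [inner_outer]
  · intro i j
    simp only [apply_eq_inner_single, inner_outer]
    exact integrable_inner_mul_inner h4 _ _

theorem integral_inner_sq_mul_norm_sq_le (h4 : Integrable (fun a => ‖a‖ ^ 4) D) (x : Vec d) :
    ∫ a, inner ℝ a x * inner ℝ a x * ‖a‖ ^ 2 ∂D ≤ specNorm (fourthMoment D) * ‖x‖ ^ 2 := by
  have h : inner ℝ x (toEuclideanCLM (n := Fin d) (𝕜 := ℝ) (fourthMoment D) x) =
      ∫ a, inner ℝ a x * inner ℝ a x * ‖a‖ ^ 2 ∂D := by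
    rw [fourthMoment, inner_toEuclideanCLM_integral]
    · simp only [inner_outer_mul_outer]
    · intro i j
      simp only [apply_eq_inner_single, inner_outer_mul_outer]
      exact integrable_inner_mul_inner_mul_norm_sq h4 _ _
  rw [← h]
  calc _ ≤ ‖x‖ * ‖toEuclideanCLM (n := Fin d) (𝕜 := ℝ) (fourthMoment D) x‖ :=
        real_inner_le_norm _ _
    _ ≤ ‖x‖ * (specNorm (fourthMoment D) * ‖x‖) := by
        gcongr; exact ContinuousLinearMap.le_opNorm _ _
    _ = _ := by ring

theorem secondMomentCLM_nonneg [IsProbabilityMeasure D] (h4 : Integrable (fun a => ‖a‖ ^ 4) D)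
    (x : Vec d) : 0 ≤ inner ℝ x (secondMomentCLM D x) := by
  rw [inner_secondMomentCLM h4]
  exact integral_nonneg fun a => mul_self_nonneg _

end Moments

/-! ### Expected progress of a single stochastic gradient step. -/

section OneStep

variable {d : ℕ} {D : Measure (Vec d)}

/-- `xᵀ (λ I - Σ) x`. -/
noncomputable def energy (D : Measure (Vec d)) (lam : ℝ) (x : Vec d) : ℝ :=
  lam * ‖x‖ ^ 2 - inner ℝ x (secondMomentCLM D x)

/-- `Σ x - a aᵀ x`. -/
noncomputable def deviation (D : Measure (Vec d)) (x a : Vec d) : Vec d :=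
  secondMomentCLM D x - (inner ℝ a x : ℝ) • a

theorem norm_deviation_sq (x a : Vec d) :
    ‖deviation D x a‖ ^ 2 = ‖secondMomentCLM D x‖ ^ 2
      - 2 * (inner ℝ a (secondMomentCLM D x) * inner ℝ a x)
      + inner ℝ a x * inner ℝ a x * ‖a‖ ^ 2 := by
  rw [deviation, norm_sub_sq_real, real_inner_smul_right, norm_smul, mul_pow, Real.norm_eq_abs,
    sq_abs, real_inner_comm a]
  ring

/-- The conclusion `0 ≤ R` matters: `ENNReal.ofReal` truncates, so a negative term inside `R` can be
moved across the inequality only once `R` is known to be nonnegative. -/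
theorem lintegral_ofReal_le_of_integral_le {α : Type*} [MeasurableSpace α] {ν : Measure α}
    {f g : α → ℝ} {R : ℝ} (hf : ∀ a, 0 ≤ f a) (hfg : ∀ a, f a ≤ g a) (hg : Integrable g ν)
    (hR : ∫ a, g a ∂ν ≤ R) :
    0 ≤ R ∧ ∫⁻ a, ENNReal.ofReal (f a) ∂ν ≤ ENNReal.ofReal R := by
  refine ⟨(integral_nonneg fun a => (hf a).trans (hfg a)).trans hR, ?_⟩
  calc ∫⁻ a, ENNReal.ofReal (f a) ∂ν ≤ ∫⁻ a, ENNReal.ofReal (g a) ∂ν :=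
        lintegral_mono fun a => ENNReal.ofReal_le_ofReal (hfg a)
    _ = ENNReal.ofReal (∫ a, g a ∂ν) :=
        (ofReal_integral_eq_lintegral_ofReal hg
          (ae_of_all _ fun a => (hf a).trans (hfg a))).symm
    _ ≤ _ := ENNReal.ofReal_le_ofReal hR

variable [IsProbabilityMeasure D]

/-- Every squared norm averaged over one sample below expands into these six terms, so integrability
and linearity are settled once. -/
theorem integral_quadratic_expansion (h4 : Integrable (fun a => ‖a‖ ^ 4) D)
    (c α β γ δ ε : ℝ) (e e₀ u : Vec d) :
    Integrable (fun a => c + α * (inner ℝ a e * inner ℝ a e) + β * (inner ℝ a e * inner ℝ a e₀)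
      + γ * (inner ℝ a u * inner ℝ a e₀) + δ * (inner ℝ a e * inner ℝ a e * ‖a‖ ^ 2)
      + ε * (inner ℝ a e₀ * inner ℝ a e₀ * ‖a‖ ^ 2)) D ∧
    ∫ a, (c + α * (inner ℝ a e * inner ℝ a e) + β * (inner ℝ a e * inner ℝ a e₀)
      + γ * (inner ℝ a u * inner ℝ a e₀) + δ * (inner ℝ a e * inner ℝ a e * ‖a‖ ^ 2)
      + ε * (inner ℝ a e₀ * inner ℝ a e₀ * ‖a‖ ^ 2)) ∂D =
    c + α * inner ℝ e (secondMomentCLM D e) + β * inner ℝ e (secondMomentCLM D e₀)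
      + γ * inner ℝ u (secondMomentCLM D e₀) + δ * (∫ a, inner ℝ a e * inner ℝ a e * ‖a‖ ^ 2 ∂D)
      + ε * (∫ a, inner ℝ a e₀ * inner ℝ a e₀ * ‖a‖ ^ 2 ∂D) := by
  have i0 : Integrable (fun _ : Vec d => c) D := integrable_const c
  have i1 := (integrable_inner_mul_inner h4 e e).const_mul α
  have i2 := (integrable_inner_mul_inner h4 e e₀).const_mul β
  have i3 := (integrable_inner_mul_inner h4 u e₀).const_mul γ
  have i4 := (integrable_inner_mul_inner_mul_norm_sq h4 e e).const_mul δ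
  have i5 := (integrable_inner_mul_inner_mul_norm_sq h4 e₀ e₀).const_mul ε
  refine ⟨((((i0.add i1).add i2).add i3).add i4).add i5, ?_⟩
  rw [integral_add ((((i0.fun_add i1).fun_add i2).fun_add i3).fun_add i4) i5,
    integral_add (((i0.fun_add i1).fun_add i2).fun_add i3) i4,
    integral_add ((i0.fun_add i1).fun_add i2) i3, integral_add (i0.fun_add i1) i2,
    integral_add i0 i1]
  simp only [integral_const_mul, inner_secondMomentCLM h4, integral_const, probReal_univ,
    one_smul]

/-- Jensen's inequality, read off from the nonnegative variance of `(aᵀx) a`, whose mean is `Σx`. -/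
theorem norm_secondMomentCLM_sq_le (h4 : Integrable (fun a => ‖a‖ ^ 4) D) (x : Vec d) :
    ‖secondMomentCLM D x‖ ^ 2 ≤ ∫ a, inner ℝ a x * inner ℝ a x * ‖a‖ ^ 2 ∂D := by
  have h := (integral_quadratic_expansion h4 (‖secondMomentCLM D x‖ ^ 2) 0 0 (-2) 0 1 0 x
    (secondMomentCLM D x)).2
  have h0 : 0 ≤ ∫ a, ‖deviation D x a‖ ^ 2 ∂D := integral_nonneg fun a => by positivity
  simp only [norm_deviation_sq] at h0
  have h1 : ∀ a : Vec d, ‖secondMomentCLM D x‖ ^ 2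
      - 2 * (inner ℝ a (secondMomentCLM D x) * inner ℝ a x)
      + inner ℝ a x * inner ℝ a x * ‖a‖ ^ 2 = ‖secondMomentCLM D x‖ ^ 2 +
      0 * (inner ℝ a (0 : Vec d) * inner ℝ a (0 : Vec d)) +
      0 * (inner ℝ a (0 : Vec d) * inner ℝ a x)
      + (-2) * (inner ℝ a (secondMomentCLM D x) * inner ℝ a x)
      + 0 * (inner ℝ a (0 : Vec d) * inner ℝ a (0 : Vec d) * ‖a‖ ^ 2)
      + 1 * (inner ℝ a x * inner ℝ a x * ‖a‖ ^ 2) := fun a => by ring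
  simp only [h1] at h0
  rw [h, real_inner_self_eq_norm_sq] at h0
  linarith

/-- The deviation has mean zero, so the cross term with `z` vanishes; its variance is at most the
second moment of `(aᵀx) a`. -/
theorem lintegral_norm_add_deviation_sq_le (h4 : Integrable (fun a => ‖a‖ ^ 4) D) {V : ℝ}
    (hV : ∀ x, ∫ a, inner ℝ a x * inner ℝ a x * ‖a‖ ^ 2 ∂D ≤ V * ‖x‖ ^ 2) (z x : Vec d) :
    ∫⁻ a, ENNReal.ofReal (‖z + deviation D x a‖ ^ 2) ∂D ≤
      ENNReal.ofReal (‖z‖ ^ 2 + V * ‖x‖ ^ 2) := by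
  obtain ⟨hi, hI⟩ := integral_quadratic_expansion h4
    (‖z‖ ^ 2 + 2 * inner ℝ z (secondMomentCLM D x) + ‖secondMomentCLM D x‖ ^ 2)
    0 (-2) (-2) 0 1 z x (secondMomentCLM D x)
  refine (lintegral_ofReal_le_of_integral_le (fun a => by positivity) (fun a => ?_) hi ?_).2
  · rw [norm_add_sq_real, norm_deviation_sq, deviation, inner_sub_right, real_inner_smul_right,
      real_inner_comm a z]
    apply le_of_eq; ring
  · rw [hI, real_inner_self_eq_norm_sq]
    nlinarith [hV x, sq_nonneg ‖secondMomentCLM D x‖]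

theorem norm_sub_add_sq_le {E : Type*} [NormedAddCommGroup E] [InnerProductSpace ℝ E]
    (x y z : E) : ‖x - y + z‖ ^ 2 ≤ 3 * (‖x‖ ^ 2 + ‖y‖ ^ 2 + ‖z‖ ^ 2) := by
  have h : ‖x - y + z‖ ≤ ‖x‖ + ‖y‖ + ‖z‖ :=
    (norm_add_le _ _).trans (by gcongr; exact norm_sub_le _ _)
  nlinarith [norm_nonneg (x - y + z), sq_nonneg (‖x‖ - ‖y‖), sq_nonneg (‖y‖ - ‖z‖),
    sq_nonneg (‖x‖ - ‖z‖)]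

/-- The variance-reduced stochastic gradient at error `e`, with reference error `e₀` and batch
error `ξ`. -/
noncomputable def stochGrad (D : Measure (Vec d)) (lam : ℝ) (e₀ ξ e a : Vec d) : Vec d :=
  (lam • e - (inner ℝ a e : ℝ) • a) - deviation D e₀ a + ξ

/-- Expected progress of one inner iteration. -/
theorem lintegral_norm_sub_stochGrad_sq_le (h4 : Integrable (fun a => ‖a‖ ^ 4) D)
    {V lam μ h : ℝ} (hμ : 0 < μ) (hV0 : 0 ≤ V) (hlam : μ ≤ lam)
    (hV : ∀ x, ∫ a, inner ℝ a x * inner ℝ a x * ‖a‖ ^ 2 ∂D ≤ V * ‖x‖ ^ 2)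
    (hB : ∀ x, μ * ‖x‖ ^ 2 ≤ energy D lam x) (hh : 0 < h) (h1 : 3 * (h * (lam + V / μ)) ≤ 1)
    (e₀ ξ e : Vec d) :
    ∫⁻ a, ENNReal.ofReal (‖e - h • stochGrad D lam e₀ ξ e a‖ ^ 2) ∂D
        + ENNReal.ofReal (h * (1 - 3 * (h * (lam + V / μ)))) * ENNReal.ofReal (energy D lam e) ≤
      ENNReal.ofReal (‖e‖ ^ 2)
        + (ENNReal.ofReal (h * (1 + 3 * (h * (lam + V / μ))) / μ) * ENNReal.ofReal (‖ξ‖ ^ 2)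
          + ENNReal.ofReal (3 * (h * (lam + V / μ)) * h) *
            ENNReal.ofReal (energy D lam e₀)) := by
  set S := lam + V / μ with hS
  set T := secondMomentCLM D
  have hE : ∀ x, 0 ≤ energy D lam x := fun x => (by positivity : 0 ≤ μ * ‖x‖ ^ 2).trans (hB x)
  have hlam0 : 0 < lam := hμ.trans_le hlam
  have hSl : lam ≤ S := by rw [hS]; have := div_nonneg hV0 hμ.le; linarith
  have hS0 : 0 < S := by linarith
  have hc : 0 ≤ h * (1 - 3 * (h * S)) := mul_nonneg hh.le (by linarith)
  have hVE : ∀ x, V * ‖x‖ ^ 2 ≤ V / μ * energy D lam x := fun x => by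
    calc V * ‖x‖ ^ 2 = V / μ * (μ * ‖x‖ ^ 2) := by field_simp
      _ ≤ _ := mul_le_mul_of_nonneg_left (hB x) (div_nonneg hV0 hμ.le)
  have hTe : 0 ≤ inner ℝ e (T e) := secondMomentCLM_nonneg h4 e
  -- Bound on `E‖(λI - aaᵀ)e‖²`: half of the cross term completes `λ E(e)`, the other half is
  -- discarded, and `V‖e‖² ≤ (V/μ) E(e)`.
  have hA : lam ^ 2 * ‖e‖ ^ 2 - 2 * lam * inner ℝ e (T e)
      + ∫ a, inner ℝ a e * inner ℝ a e * ‖a‖ ^ 2 ∂D ≤ S * energy D lam e := by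
    have := hVE e
    have h2 := hV e
    have : S * energy D lam e = lam * (lam * ‖e‖ ^ 2 - inner ℝ e (T e))
      + V / μ * energy D lam e := by rw [hS, add_mul]; rfl
    nlinarith [mul_nonneg hlam0.le hTe]
  have hD : ∫ a, inner ℝ a e₀ * inner ℝ a e₀ * ‖a‖ ^ 2 ∂D ≤ S * energy D lam e₀ := by
    refine (hV e₀).trans ((hVE e₀).trans (mul_le_mul_of_nonneg_right ?_ (hE _)))
    linarith
  -- Young's inequality weighted by `μ`; it spends one of the two copies of `E(e)` that the linear
  -- term provides.
  have hξ : -(2 * inner ℝ ξ e) ≤ ‖ξ‖ ^ 2 / μ + energy D lam e := by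
    have h2 := abs_le.1 (abs_real_inner_le_norm ξ e)
    have h3 : 2 * (‖ξ‖ * ‖e‖) ≤ ‖ξ‖ ^ 2 / μ + μ * ‖e‖ ^ 2 := by
      have : ‖ξ‖ ^ 2 / μ + μ * ‖e‖ ^ 2 - 2 * (‖ξ‖ * ‖e‖) = (‖ξ‖ - μ * ‖e‖) ^ 2 / μ := by
        field_simp; ring
      have : 0 ≤ (‖ξ‖ - μ * ‖e‖) ^ 2 / μ := by positivity
      linarith
    linarith [hB e]
  have hξ2 : ‖ξ‖ ^ 2 ≤ S * (‖ξ‖ ^ 2 / μ) := by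
    rw [← mul_div_assoc, le_div_iff₀ hμ]
    nlinarith [sq_nonneg ‖ξ‖]
  rw [← ENNReal.ofReal_mul hc, ← ENNReal.ofReal_mul (by positivity),
    ← ENNReal.ofReal_mul (by positivity),
    ← ENNReal.ofReal_add (by positivity) (mul_nonneg (by positivity) (hE _)),
    ← ENNReal.ofReal_add (by positivity)
      (add_nonneg (by positivity) (mul_nonneg (by positivity) (hE _)))]
  -- Coefficients of `‖e‖² - 2h⟨e, G⟩ + 3h²(‖(λI - aaᵀ)e‖² + ‖deviation‖² + ‖ξ‖²)`, the factor `3`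
  -- coming from `norm_sub_add_sq_le`.
  obtain ⟨hi, hI⟩ := integral_quadratic_expansion h4
    (‖e‖ ^ 2 - 2 * h * (lam * ‖e‖ ^ 2 - inner ℝ e (T e₀) + inner ℝ ξ e)
      + 3 * h ^ 2 * (lam ^ 2 * ‖e‖ ^ 2 + ‖T e₀‖ ^ 2 + ‖ξ‖ ^ 2))
    (2 * h - 6 * h ^ 2 * lam) (-(2 * h)) (-(6 * h ^ 2)) (3 * h ^ 2) (3 * h ^ 2) e e₀ (T e₀)
  obtain ⟨hR, hmain⟩ : 0 ≤ ‖e‖ ^ 2 + (h * (1 + 3 * (h * S)) / μ * ‖ξ‖ ^ 2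
        + 3 * (h * S) * h * energy D lam e₀) - h * (1 - 3 * (h * S)) * energy D lam e ∧
      ∫⁻ a, ENNReal.ofReal (‖e - h • stochGrad D lam e₀ ξ e a‖ ^ 2) ∂D ≤
      ENNReal.ofReal (‖e‖ ^ 2 + (h * (1 + 3 * (h * S)) / μ * ‖ξ‖ ^ 2
        + 3 * (h * S) * h * energy D lam e₀) - h * (1 - 3 * (h * S)) * energy D lam e) := by
    refine lintegral_ofReal_le_of_integral_le (fun a => by positivity) (fun a => ?_) hi ?_
    · have hG := norm_sub_add_sq_le (lam • e - (inner ℝ a e : ℝ) • a) (deviation D e₀ a) ξ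
      rw [norm_deviation_sq, norm_sub_sq_real, norm_smul, norm_smul, mul_pow, mul_pow,
        Real.norm_eq_abs, Real.norm_eq_abs, sq_abs, sq_abs, real_inner_smul_left,
        real_inner_smul_right, real_inner_comm a e] at hG
      rw [norm_sub_sq_real, real_inner_smul_right, norm_smul, mul_pow, Real.norm_eq_abs, sq_abs]
      have hin : inner ℝ e (stochGrad D lam e₀ ξ e a) = lam * ‖e‖ ^ 2
          - inner ℝ a e * inner ℝ a e - inner ℝ e (T e₀) + inner ℝ a e * inner ℝ a e₀
          + inner ℝ ξ e := by
        simp only [stochGrad, deviation, inner_add_right, inner_sub_right, real_inner_smul_right,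
          real_inner_self_eq_norm_sq, real_inner_comm a e, real_inner_comm ξ e]
        ring
      rw [hin]
      have := mul_le_mul_of_nonneg_left hG (sq_nonneg h)
      unfold stochGrad
      simp only [T] at *
      linarith
    · rw [hI, real_inner_self_eq_norm_sq]
      have hA' := mul_le_mul_of_nonneg_left hA (by positivity : 0 ≤ 3 * h ^ 2)
      have hD' := mul_le_mul_of_nonneg_left hD (by positivity : 0 ≤ 3 * h ^ 2)
      have hξ' := mul_le_mul_of_nonneg_left hξ hh.le
      have hξ2' := mul_le_mul_of_nonneg_left hξ2 (by positivity : 0 ≤ 3 * h ^ 2)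
      have hT0 : 0 ≤ 3 * h ^ 2 * ‖T e₀‖ ^ 2 := by positivity
      have e1 : h * (1 + 3 * (h * S)) / μ * ‖ξ‖ ^ 2 =
        h * (‖ξ‖ ^ 2 / μ) + 3 * h ^ 2 * (S * (‖ξ‖ ^ 2 / μ)) := by ring
      have e2 : h * (lam * ‖e‖ ^ 2 - inner ℝ e (T e)) = h * energy D lam e := rfl
      rw [e1]
      linarith
  have hpos : 0 ≤ h * (1 - 3 * (h * S)) * energy D lam e := mul_nonneg hc (hE _)
  refine (add_le_add_left hmain _).trans ?_
  rw [← ENNReal.ofReal_add hR hpos]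
  exact ENNReal.ofReal_le_ofReal (by linarith)

end OneStep

/-! ### Explicit gradients and the error recursion. -/

section Gradient

variable {d : ℕ}

theorem psi_eq (lam : ℝ) (b a x : Vec d) :
    psi lam b a x = 1 / 2 * (lam * ‖x‖ ^ 2 - inner ℝ a x ^ 2) - inner ℝ b x := by
  have h1 : x.ofLp ⬝ᵥ x.ofLp = ‖x‖ ^ 2 := by
    rw [← real_inner_self_eq_norm_sq, EuclideanSpace.inner_eq_star_dotProduct, star_trivial]
  have h2 : x.ofLp ⬝ᵥ (outer a *ᵥ x.ofLp) = inner ℝ a x ^ 2 := by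
    rw [← inner_toEuclideanCLM, inner_outer, sq]
  rw [psi, sub_mulVec, dotProduct_sub, h2, smul_mulVec, one_mulVec, dotProduct_smul, h1,
    EuclideanSpace.inner_eq_star_dotProduct b x, star_trivial, dotProduct_comm b.ofLp, smul_eq_mul]

theorem hasGradientAt_psi (lam : ℝ) (b a x : Vec d) :
    HasGradientAt (psi lam b a) (lam • x - (inner ℝ a x : ℝ) • a - b) x := by
  rw [hasGradientAt_iff_hasFDerivAt]
  have h1 := (hasStrictFDerivAt_norm_sq x).hasFDerivAt.const_mul lam
  have h2 := ((innerSL ℝ a).hasFDerivAt (x := x)).pow 2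
  have h3 := (innerSL ℝ b).hasFDerivAt (x := x)
  have h4 := ((h1.sub h2).const_mul (1 / 2)).sub h3
  refine (h4.congr_fderiv ?_).congr_of_eventuallyEq (Filter.Eventually.of_forall fun z => ?_)
  · ext v
    simp
    ring
  · simp [psi_eq]

theorem gradient_psi (lam : ℝ) (b a x : Vec d) :
    gradient (psi lam b a) x = lam • x - (inner ℝ a x : ℝ) • a - b :=
  (hasGradientAt_psi lam b a x).gradient

theorem gradient_batchObjective (lam : ℝ) (b : Vec d) (k : ℕ) (s : ℕ → Vec d) (x : Vec d) :
    gradient (batchObjective lam b k s) x =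
      (1 / (k : ℝ)) • ∑ i ∈ Finset.range k, (lam • x - (inner ℝ (s i) x : ℝ) • s i - b) := by
  refine HasGradientAt.gradient ?_
  rw [hasGradientAt_iff_hasFDerivAt]
  have h := (HasFDerivAt.fun_sum (u := Finset.range k) fun i _ =>
    (hasGradientAt_iff_hasFDerivAt.1 (hasGradientAt_psi lam b (s i) x))).const_mul (1 / (k : ℝ))
  refine h.congr_fderiv ?_
  simp [map_sum]

/-- The error `(Σ - (1/k) ∑ aᵢ aᵢᵀ) x` of the batch. -/
noncomputable def batchError (D : Measure (Vec d)) (k : ℕ) (s : ℕ → Vec d) (x : Vec d) : Vec d :=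
  (1 / (k : ℝ)) • ∑ i ∈ Finset.range k, deviation D x (s i)

/-- Substituting `b = Bx*` turns the update into a recursion for errors. The exception is `ξ`, which
is evaluated at `x₀` itself: the batch samples `Σx₀`, not `Σ(x₀ - x*)`. -/
theorem ssvrgInner_succ_sub (D : Measure (Vec d)) {lam L η : ℝ} {b xs : Vec d}
    (hb : b = lam • xs - secondMomentCLM D xs) {k : ℕ} (hk : 0 < k) (s : ℕ → Vec d) (x₀ : Vec d)
    (t : ℕ) :
    ssvrgInner lam b L η k s x₀ (t + 1) - xs = (ssvrgInner lam b L η k s x₀ t - xs) -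
      (η / L) • stochGrad D lam (x₀ - xs) (batchError D k s x₀)
        (ssvrgInner lam b L η k s x₀ t - xs) (s (k + t)) := by
  have hk' : (k : ℝ) ≠ 0 := by positivity
  have hg : gradient (batchObjective lam b k s) x₀ =
      lam • x₀ - b - secondMomentCLM D x₀ + batchError D k s x₀ := by
    rw [gradient_batchObjective, batchError]
    simp only [deviation, Finset.sum_sub_distrib, Finset.sum_const, Finset.card_range]
    simp only [← Nat.cast_smul_eq_nsmul ℝ]
    simp only [smul_sub, smul_smul, one_div, inv_mul_cancel₀ hk', one_smul]
    simp only [← mul_assoc, inv_mul_cancel₀ hk', one_mul]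
    abel
  rw [ssvrgInner]
  simp only [hg, gradient_psi, stochGrad, deviation]
  generalize ssvrgInner lam b L η k s x₀ t = x
  have : ∀ u v w : Vec d, u = v → x - (η / L) • u - w = x - w - (η / L) • v := by
    rintro u v w rfl; abel
  apply this
  subst hb
  simp only [map_sub, inner_sub_right, sub_smul, smul_sub]
  abel

end Gradient

/-! ### Dependence of the iterates on finitely many samples, and measurability. -/

section Locality

variable {d : ℕ}

theorem ssvrgInner_congr (lam : ℝ) (b : Vec d) (L η : ℝ) (k : ℕ) {s s' : ℕ → Vec d}
    (x₀ : Vec d) : ∀ t : ℕ, (∀ n < k + t, s n = s' n) →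
      ssvrgInner lam b L η k s x₀ t = ssvrgInner lam b L η k s' x₀ t
  | 0, _ => rfl
  | t + 1, h => by
    have hb : batchObjective lam b k s = batchObjective lam b k s' := by
      ext x
      unfold batchObjective
      congr 1
      refine Finset.sum_congr rfl fun i hi => ?_
      rw [h i (by have := Finset.mem_range.1 hi; omega)]
    simp only [ssvrgInner]
    rw [ssvrgInner_congr lam b L η k x₀ t fun n hn => h n (by omega), h (k + t) (by omega), hb]

theorem measurable_deviation {α : Type*} [MeasurableSpace α] (D : Measure (Vec d))
    {f g : α → Vec d} (hf : Measurable f) (hg : Measurable g) :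
    Measurable fun w => deviation D (f w) (g w) := by
  unfold deviation
  fun_prop

theorem measurable_batchError {α : Type*} [MeasurableSpace α] (D : Measure (Vec d)) (k : ℕ)
    {s : α → ℕ → Vec d} {f : α → Vec d} (hs : ∀ n, Measurable fun w => s w n)
    (hf : Measurable f) : Measurable fun w => batchError D k (s w) (f w) := by
  unfold batchError
  have := fun i => measurable_deviation D hf (hs i)
  fun_prop

theorem measurable_stochGrad {α : Type*} [MeasurableSpace α] (D : Measure (Vec d)) (lam : ℝ)
    {e₀ ξ e a : α → Vec d} (h0 : Measurable e₀) (hξ : Measurable ξ) (he : Measurable e)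
    (ha : Measurable a) : Measurable fun w => stochGrad D lam (e₀ w) (ξ w) (e w) (a w) := by
  unfold stochGrad
  have := measurable_deviation D h0 ha
  fun_prop

theorem measurable_energy {α : Type*} [MeasurableSpace α] (D : Measure (Vec d)) (lam : ℝ)
    {e : α → Vec d} (he : Measurable e) : Measurable fun w => energy D lam (e w) := by
  unfold energy
  fun_prop

theorem measurable_ssvrgInner {α : Type*} [MeasurableSpace α] (lam : ℝ) (b : Vec d) (L η : ℝ)
    (k : ℕ) {s : α → ℕ → Vec d} {f : α → Vec d} (hs : ∀ n, Measurable fun w => s w n)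
    (hf : Measurable f) : ∀ t, Measurable fun w => ssvrgInner lam b L η k (s w) (f w) t
  | 0 => hf
  | t + 1 => by
    have ih := measurable_ssvrgInner lam b L η k hs hf t
    simp only [ssvrgInner, gradient_psi, gradient_batchObjective]
    fun_prop

end Locality

/-! ### Contraction over one round. -/

section Round

variable {d : ℕ} {D : Measure (Vec d)} [IsProbabilityMeasure D]
  {Ω : Type*} [MeasurableSpace Ω] {P : Measure Ω} [IsProbabilityMeasure P]
  {a : ℕ → Ω → Vec d}

/-- A martingale argument: given `x₀` and the earlier batch samples, the next deviation has mean
zero, so second moments add up. -/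
theorem lintegral_sum_deviation_sq_le (h4 : Integrable (fun a => ‖a‖ ^ 4) D) {V : ℝ}
    (hV0 : 0 ≤ V)
    (hV : ∀ x, ∫ a, inner ℝ a x * inner ℝ a x * ‖a‖ ^ 2 ∂D ≤ V * ‖x‖ ^ 2)
    (ha : ∀ n, Measurable (a n)) (hD : ∀ n, P.map (a n) = D) (hind : iIndepFun a P)
    {U : ℕ} {x₀ : (ℕ → Vec d) → Vec d} (hx₀ : Measurable x₀) (hdep : DependsOn x₀ (Set.Iio U))
    (k : ℕ) :
    ∫⁻ ω, ENNReal.ofReal (‖∑ i ∈ Finset.range k,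
        deviation D (x₀ fun n => a n ω) (a (U + i) ω)‖ ^ 2) ∂P ≤
      k * (ENNReal.ofReal V * ∫⁻ ω, ENNReal.ofReal (‖x₀ fun n => a n ω‖ ^ 2) ∂P) := by
  induction k with
  | zero => simp
  | succ k ih =>
    let X : (ℕ → Vec d) → Vec d × Vec d := fun s =>
      (∑ i ∈ Finset.range k, deviation D (x₀ s) (s (U + i)), x₀ s)
    have hXm : Measurable X := by
      have := fun i => measurable_deviation D hx₀ (measurable_pi_apply (U + i))
      exact (Finset.measurable_fun_sum _ fun i _ => this i).prodMk hx₀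
    have hXd : DependsOn X (Set.Iio (U + k)) := by
      intro s s' h
      have h0 : x₀ s = x₀ s' := hdep fun i hi => h i (by simp at *; omega)
      simp only [X, h0]
      congr 1
      refine Finset.sum_congr rfl fun i hi => ?_
      rw [h (U + i) (by simp at *; omega)]
    let f : (Vec d × Vec d) × Vec d → ENNReal := fun w =>
      ENNReal.ofReal (‖w.1.1 + deviation D w.1.2 w.2‖ ^ 2)
    have hf : Measurable f := by
      have := measurable_deviation D (measurable_snd.comp measurable_fst)
        (measurable_snd (α := Vec d × Vec d) (β := Vec d))
      simp only [Function.comp_def] at this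
      fun_prop
    have h := lintegral_prefix_next ha hind hXm hXd hf
    simp only [f, X, hD, ← Finset.sum_range_succ (fun i => deviation D _ _)] at h
    have hm : Measurable fun ω => x₀ fun n => a n ω := hx₀.comp (measurable_pi_lambda _ ha)
    calc _ = _ := h
      _ ≤ ∫⁻ ω, (ENNReal.ofReal (‖∑ i ∈ Finset.range k,
            deviation D (x₀ fun n => a n ω) (a (U + i) ω)‖ ^ 2) + ENNReal.ofReal V *
              ENNReal.ofReal (‖x₀ fun n => a n ω‖ ^ 2)) ∂P := by
          refine lintegral_mono fun ω => ?_
          refine (lintegral_norm_add_deviation_sq_le h4 hV _ _).trans (le_of_eq ?_)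
          rw [ENNReal.ofReal_add (by positivity) (by positivity), ENNReal.ofReal_mul hV0]
      _ ≤ _ := by
          rw [lintegral_add_right _ (by fun_prop), lintegral_const_mul _ (by fun_prop)]
          push_cast
          rw [add_mul, one_mul]
          gcongr

theorem lintegral_batchError_sq_le (h4 : Integrable (fun a => ‖a‖ ^ 4) D) {V : ℝ}
    (hV0 : 0 ≤ V)
    (hV : ∀ x, ∫ a, inner ℝ a x * inner ℝ a x * ‖a‖ ^ 2 ∂D ≤ V * ‖x‖ ^ 2)
    (ha : ∀ n, Measurable (a n)) (hD : ∀ n, P.map (a n) = D) (hind : iIndepFun a P)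
    {U : ℕ} {x₀ : (ℕ → Vec d) → Vec d} (hx₀ : Measurable x₀) (hdep : DependsOn x₀ (Set.Iio U))
    {k : ℕ} (hk : 0 < k) :
    ∫⁻ ω, ENNReal.ofReal (‖batchError D k (fun n => a (U + n) ω) (x₀ fun n => a n ω)‖ ^ 2) ∂P ≤
      ENNReal.ofReal (V / k) * ∫⁻ ω, ENNReal.ofReal (‖x₀ fun n => a n ω‖ ^ 2) ∂P := by
  have hk' : (0 : ℝ) < k := by positivity
  have hm : Measurable fun ω => x₀ fun n => a n ω := hx₀.comp (measurable_pi_lambda _ ha)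
  have hmd : ∀ i, Measurable fun ω => deviation D (x₀ fun n => a n ω) (a (U + i) ω) :=
    fun i => measurable_deviation D hm (ha _)
  simp only [batchError, norm_smul, mul_pow]
  simp only [ENNReal.ofReal_mul (sq_nonneg ‖(1 / (k : ℝ))‖)]
  rw [lintegral_const_mul _ (by fun_prop)]
  refine (mul_le_mul_right (lintegral_sum_deviation_sq_le h4 hV0 hV ha hD hind hx₀ hdep k)
    _).trans (le_of_eq ?_)
  rw [← ENNReal.ofReal_natCast k, ← mul_assoc, ← mul_assoc, ← ENNReal.ofReal_mul (by positivity),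
    ← ENNReal.ofReal_mul (by positivity)]
  congr 2
  rw [Real.norm_of_nonneg (by positivity)]
  field_simp

/-- Telescoped progress of the inner iterations. -/
theorem lintegral_inner_telescope (h4 : Integrable (fun a => ‖a‖ ^ 4) D)
    {V lam μ L η h : ℝ} (hμ : 0 < μ) (hV0 : 0 ≤ V) (hlam : μ ≤ lam)
    (hV : ∀ x, ∫ a, inner ℝ a x * inner ℝ a x * ‖a‖ ^ 2 ∂D ≤ V * ‖x‖ ^ 2)
    (hB : ∀ x, μ * ‖x‖ ^ 2 ≤ energy D lam x) (hL : L = lam + V / μ) (hh : h = η / L)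
    (hh0 : 0 < h) (h1 : 3 * (h * L) ≤ 1)
    {b xs : Vec d} (hb : b = lam • xs - secondMomentCLM D xs)
    (ha : ∀ n, Measurable (a n)) (hD : ∀ n, P.map (a n) = D) (hind : iIndepFun a P)
    {U : ℕ} {x₀ : (ℕ → Vec d) → Vec d} (hx₀ : Measurable x₀) (hdep : DependsOn x₀ (Set.Iio U))
    {k : ℕ} (hk : 0 < k) (n : ℕ) :
    ENNReal.ofReal (h * (1 - 3 * (h * L))) * ∑ t ∈ Finset.range n,
        ∫⁻ ω, ENNReal.ofReal (energy D lam (ssvrgInner lam b L η k (fun n => a (U + n) ω)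
          (x₀ fun n => a n ω) t - xs)) ∂P ≤
      ∫⁻ ω, ENNReal.ofReal (‖(x₀ fun n => a n ω) - xs‖ ^ 2) ∂P
      + n * (ENNReal.ofReal (h * (1 + 3 * (h * L)) / μ) *
          ∫⁻ ω, ENNReal.ofReal
            (‖batchError D k (fun n => a (U + n) ω) (x₀ fun n => a n ω)‖ ^ 2) ∂P
        + ENNReal.ofReal (3 * (h * L) * h) *
          ∫⁻ ω, ENNReal.ofReal (energy D lam ((x₀ fun n => a n ω) - xs)) ∂P) := by
  have hs : Measurable fun ω n => a n ω := measurable_pi_lambda _ ha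
  have hm : Measurable fun ω => x₀ fun n => a n ω := hx₀.comp hs
  let e : ℕ → (ℕ → Vec d) → Vec d := fun t s =>
    ssvrgInner lam b L η k (fun n => s (U + n)) (x₀ s) t - xs
  let ξ : (ℕ → Vec d) → Vec d := fun s => batchError D k (fun n => s (U + n)) (x₀ s)
  have hem : ∀ t, Measurable (e t) := fun t =>
    (measurable_ssvrgInner lam b L η k (s := fun (s : ℕ → Vec d) n => s (U + n))
      (fun n => measurable_pi_apply _) hx₀ t).sub_const _
  have hξm : Measurable ξ := measurable_batchError D k (fun n => measurable_pi_apply _) hx₀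
  have hem' : ∀ t, Measurable fun ω => e t fun n => a n ω := fun t => (hem t).comp hs
  have hξm' : Measurable fun ω => ξ fun n => a n ω := hξm.comp hs
  have hEm' : ∀ t, Measurable fun ω => energy D lam (e t fun n => a n ω) :=
    fun t => measurable_energy D lam (hem' t)
  have hstep : ∀ t, ∫⁻ ω, ENNReal.ofReal (‖e (t + 1) fun n => a n ω‖ ^ 2) ∂P
      + ENNReal.ofReal (h * (1 - 3 * (h * L))) *
        ∫⁻ ω, ENNReal.ofReal (energy D lam (e t fun n => a n ω)) ∂P ≤
      ∫⁻ ω, ENNReal.ofReal (‖e t fun n => a n ω‖ ^ 2) ∂P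
      + (ENNReal.ofReal (h * (1 + 3 * (h * L)) / μ) *
          ∫⁻ ω, ENNReal.ofReal (‖ξ fun n => a n ω‖ ^ 2) ∂P
        + ENNReal.ofReal (3 * (h * L) * h) *
          ∫⁻ ω, ENNReal.ofReal (energy D lam (e 0 fun n => a n ω)) ∂P) := by
    intro t
    -- Reference error, batch error and current error are all determined by samples before index `U
    -- + k + t`, the one used by this step.
    let X : (ℕ → Vec d) → Vec d × Vec d × Vec d := fun s => (e 0 s, ξ s, e t s)
    have hXm : Measurable X := (hem 0).prodMk (hξm.prodMk (hem t))
    have hXd : DependsOn X (Set.Iio (U + (k + t))) := by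
      intro s s' hss
      have h0 : x₀ s = x₀ s' := hdep fun i hi => hss i (by simp at *; omega)
      have hi : ∀ n < k + t, s (U + n) = s' (U + n) := fun n hn => hss _ (by simp; omega)
      simp only [X, e, ξ, h0]
      refine Prod.ext rfl (Prod.ext ?_ ?_)
      · simp only [batchError]
        congr 1
        refine Finset.sum_congr rfl fun i hi' => ?_
        rw [hi i (by simp at *; omega)]
      · simp only
        rw [ssvrgInner_congr lam b L η k _ t hi]
    let f : (Vec d × Vec d × Vec d) × Vec d → ENNReal := fun w =>
      ENNReal.ofReal (‖w.1.2.2 - h • stochGrad D lam w.1.1 w.1.2.1 w.1.2.2 w.2‖ ^ 2)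
    have hf : Measurable f := by
      have : Measurable fun w : (Vec d × Vec d × Vec d) × Vec d =>
          stochGrad D lam w.1.1 w.1.2.1 w.1.2.2 w.2 :=
        measurable_stochGrad D lam (by fun_prop) (by fun_prop) (by fun_prop) (by fun_prop)
      fun_prop
    have hX := lintegral_prefix_next ha hind hXm hXd hf
    have he1 : ∀ ω, e (t + 1) (fun n => a n ω) = (e t fun n => a n ω) -
        h • stochGrad D lam (e 0 fun n => a n ω) (ξ fun n => a n ω) (e t fun n => a n ω)
          (a (U + (k + t)) ω) := fun ω => by
      rw [hh]
      exact ssvrgInner_succ_sub D hb hk _ _ t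
    have hl : ∫⁻ ω, ENNReal.ofReal (‖e (t + 1) fun n => a n ω‖ ^ 2) ∂P =
        ∫⁻ ω, f (X fun n => a n ω, a (U + (k + t)) ω) ∂P :=
      lintegral_congr fun ω => by rw [he1]
    rw [hl, hX, hD, ← lintegral_const_mul _ (by fun_prop), ← lintegral_const_mul _ (by fun_prop),
      ← lintegral_const_mul _ (by fun_prop), ← lintegral_add_right _ (by fun_prop),
      ← lintegral_add_right _ (by fun_prop), ← lintegral_add_left (by fun_prop)]
    refine lintegral_mono fun ω => ?_
    subst hL
    exact lintegral_norm_sub_stochGrad_sq_le h4 hμ hV0 hlam hV hB hh0 h1 _ _ _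
  have hind' : ∀ n : ℕ, ∫⁻ ω, ENNReal.ofReal (‖e n fun n => a n ω‖ ^ 2) ∂P
      + ENNReal.ofReal (h * (1 - 3 * (h * L))) * ∑ t ∈ Finset.range n,
        ∫⁻ ω, ENNReal.ofReal (energy D lam (e t fun n => a n ω)) ∂P ≤
      ∫⁻ ω, ENNReal.ofReal (‖e 0 fun n => a n ω‖ ^ 2) ∂P
      + n * (ENNReal.ofReal (h * (1 + 3 * (h * L)) / μ) *
          ∫⁻ ω, ENNReal.ofReal (‖ξ fun n => a n ω‖ ^ 2) ∂P
        + ENNReal.ofReal (3 * (h * L) * h) *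
          ∫⁻ ω, ENNReal.ofReal (energy D lam (e 0 fun n => a n ω)) ∂P) := by
    intro n
    induction n with
    | zero => simp
    | succ n ih =>
      rw [Finset.sum_range_succ, mul_add, Nat.cast_succ, add_mul, one_mul]
      calc _ = _ := by rw [add_left_comm, add_comm]
        _ ≤ _ := add_le_add_left (hstep n) _
        _ = _ := by rw [add_right_comm]
        _ ≤ _ := add_le_add_left ih _
        _ = _ := add_assoc _ _ _
  exact le_add_self.trans (hind' n)

/-- One round contracts the expected error, summed over the possible numbers of inner
iterations. -/
theorem sum_lintegral_energy_round_le (h4 : Integrable (fun a => ‖a‖ ^ 4) D)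
    {V lam μ L Λ ρ : ℝ} (hμ : 0 < μ) (hV0 : 0 ≤ V) (hlam : μ ≤ lam)
    (hV : ∀ x, ∫ a, inner ℝ a x * inner ℝ a x * ‖a‖ ^ 2 ∂D ≤ V * ‖x‖ ^ 2)
    (hB : ∀ x, μ * ‖x‖ ^ 2 ≤ energy D lam x) (hL : L = lam + V / μ)
    {b xs : Vec d} (hb : b = lam • xs - secondMomentCLM D xs) (hxs : energy D lam xs ≤ Λ)
    (hρ0 : 0 < ρ) (hρ1 : ρ ≤ 1)
    (ha : ∀ n, Measurable (a n)) (hD : ∀ n, P.map (a n) = D) (hind : iIndepFun a P)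
    {U : ℕ} {x₀ : (ℕ → Vec d) → Vec d} (hx₀ : Measurable x₀) (hdep : DependsOn x₀ (Set.Iio U))
    {k m : ℕ} (hk : 0 < k) (hkV : V / (μ ^ 2 * (1 / 64 * ρ)) ≤ k)
    (hm0 : 1 ≤ m) (hm : L / (μ * (1 / 64) ^ 2) ≤ m) :
    ∑ j ∈ Finset.Icc 1 m,
        ∫⁻ ω, ENNReal.ofReal (energy D lam (ssvrgInner lam b L (1 / 64 / 8) k
          (fun n => a (U + n) ω) (x₀ fun n => a n ω) j - xs)) ∂P ≤
      m * (ENNReal.ofReal (1 / 4) *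
        ∫⁻ ω, ENNReal.ofReal (energy D lam ((x₀ fun n => a n ω) - xs)) ∂P
          + ENNReal.ofReal (ρ / 4 * Λ)) := by
  have hE : ∀ x, 0 ≤ energy D lam x := fun x => (by positivity : 0 ≤ μ * ‖x‖ ^ 2).trans (hB x)
  have hlam0 : 0 < lam := hμ.trans_le hlam
  have hL0 : 0 < L := by rw [hL]; positivity
  have hΛ : 0 ≤ Λ := (hE xs).trans hxs
  set h : ℝ := 1 / 64 / 8 / L with hh
  have hh0 : 0 < h := by positivity
  have hhL : h * L = 1 / 512 := by rw [hh]; field_simp; norm_num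
  have hk' : (0 : ℝ) < k := by positivity
  have hm' : (1 : ℝ) ≤ m := by exact_mod_cast hm0
  have hxm : Measurable fun ω => x₀ fun n => a n ω := hx₀.comp (measurable_pi_lambda _ ha)
  -- The horizon is `m + 1` because the sum over `t < m + 1` contains the indices `1, …, m` to be
  -- averaged; the extra step is absorbed by `m + 1 ≤ 2m`.
  have htel := lintegral_inner_telescope h4 hμ hV0 hlam hV hB hL hh hh0 (by rw [hhL]; norm_num) hb
    ha hD hind hx₀ hdep hk (m + 1)
  have hbat := lintegral_batchError_sq_le h4 hV0 hV ha hD hind hx₀ hdep hk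
  set Q := ∫⁻ ω, ENNReal.ofReal (energy D lam ((x₀ fun n => a n ω) - xs)) ∂P with hQ
  set W := ∫⁻ ω, ENNReal.ofReal
            (‖batchError D k (fun n => a (U + n) ω) (x₀ fun n => a n ω)‖ ^ 2) ∂P
  -- No finiteness of the initial expected energy is assumed; if it is infinite the bound is
  -- trivial.
  by_cases hQtop : Q = ⊤
  · rw [hQtop, ENNReal.mul_top (by simp), top_add, ENNReal.mul_top (by simp; omega)]
    exact le_top
  obtain ⟨q, hq0, hq⟩ : ∃ q : ℝ, 0 ≤ q ∧ Q = ENNReal.ofReal q :=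
    ⟨Q.toReal, ENNReal.toReal_nonneg, (ENNReal.ofReal_toReal hQtop).symm⟩
  have hx : ∫⁻ ω, ENNReal.ofReal (‖x₀ fun n => a n ω‖ ^ 2) ∂P ≤
      ENNReal.ofReal (2 / μ * (q + Λ)) := by
    rw [ENNReal.ofReal_mul (by positivity), ENNReal.ofReal_add hq0 hΛ, ← hq, hQ]
    have hEm := measurable_energy D lam (hxm.sub_const xs)
    calc _ ≤ ∫⁻ ω, ENNReal.ofReal (2 / μ) *
          (ENNReal.ofReal (energy D lam ((x₀ fun n => a n ω) - xs)) + ENNReal.ofReal Λ) ∂P := by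
          refine lintegral_mono fun ω => ?_
          rw [← ENNReal.ofReal_add (hE _) hΛ, ← ENNReal.ofReal_mul (by positivity)]
          refine ENNReal.ofReal_le_ofReal ?_
          generalize (x₀ fun n => a n ω) = x
          have h1 := hB (x - xs)
          have h2 := (hB xs).trans hxs
          have h3 : ‖x‖ ^ 2 ≤ 2 * (‖x - xs‖ ^ 2 + ‖xs‖ ^ 2) := by
            have h5 : ‖x‖ ≤ ‖x - xs‖ + ‖xs‖ := by simpa using norm_add_le (x - xs) xs
            nlinarith [norm_nonneg x, sq_nonneg (‖x - xs‖ - ‖xs‖)]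
          calc ‖x‖ ^ 2 ≤ 2 * (‖x - xs‖ ^ 2 + ‖xs‖ ^ 2) := h3
            _ = 2 / μ * (μ * ‖x - xs‖ ^ 2 + μ * ‖xs‖ ^ 2) := by field_simp
            _ ≤ _ := by gcongr
      _ = _ := by
          rw [lintegral_const_mul _ (by fun_prop), lintegral_add_right _ (by fun_prop)]
          simp
  -- The batch size condition gives `V/k ≤ μ²ρ/64`, multiplied by `E‖x₀‖² ≤ (2/μ)(q + Λ)`.
  have hW : W ≤ ENNReal.ofReal (ρ / 32 * μ * (q + Λ)) := by
    refine hbat.trans ((mul_le_mul_right hx _).trans ?_)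
    rw [← ENNReal.ofReal_mul (by positivity)]
    refine ENNReal.ofReal_le_ofReal ?_
    have : V / k ≤ μ ^ 2 * (1 / 64 * ρ) := by
      rw [div_le_iff₀ (by positivity)] at hkV
      rw [div_le_iff₀ hk']
      linarith
    calc V / k * (2 / μ * (q + Λ)) ≤ μ ^ 2 * (1 / 64 * ρ) * (2 / μ * (q + Λ)) := by gcongr
      _ = _ := by field_simp; ring
  have hx2 : ∫⁻ ω, ENNReal.ofReal (‖(x₀ fun n => a n ω) - xs‖ ^ 2) ∂P ≤
      ENNReal.ofReal (1 / μ * q) := by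
    rw [ENNReal.ofReal_mul (by positivity), ← hq, hQ,
      ← lintegral_const_mul _ (measurable_energy D lam (hxm.sub_const xs)).ennreal_ofReal]
    refine lintegral_mono fun ω => ?_
    rw [← ENNReal.ofReal_mul (by positivity)]
    refine ENNReal.ofReal_le_ofReal ?_
    rw [div_mul_eq_mul_div, one_mul, le_div_iff₀ hμ, mul_comm]
    exact hB _
  -- From `m ≥ 64² L/μ` and `h = 1/(512 L)`, so that `m h ≥ 8/μ`.
  have hμm : 1 / μ ≤ m * h / 8 := by
    rw [div_le_iff₀ (by positivity)] at hm
    have : 1 / μ = L / μ / L := by field_simp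
    rw [hh, div_le_iff₀ hμ]
    field_simp
    linarith
  have hc0 : 0 < h * (1 - 3 * (h * L)) := by rw [hhL]; positivity
  have hsub : ∑ j ∈ Finset.Icc 1 m,
      ∫⁻ ω, ENNReal.ofReal (energy D lam (ssvrgInner lam b L (1 / 64 / 8) k
        (fun n => a (U + n) ω) (x₀ fun n => a n ω) j - xs)) ∂P ≤
      ∑ j ∈ Finset.range (m + 1),
      ∫⁻ ω, ENNReal.ofReal (energy D lam (ssvrgInner lam b L (1 / 64 / 8) k
        (fun n => a (U + n) ω) (x₀ fun n => a n ω) j - xs)) ∂P :=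
    Finset.sum_le_sum_of_subset fun j hj => by simp at *; omega
  have hfin : ENNReal.ofReal (h * (1 - 3 * (h * L))) * ∑ j ∈ Finset.Icc 1 m,
      ∫⁻ ω, ENNReal.ofReal (energy D lam (ssvrgInner lam b L (1 / 64 / 8) k
        (fun n => a (U + n) ω) (x₀ fun n => a n ω) j - xs)) ∂P ≤
      ENNReal.ofReal (h * (1 - 3 * (h * L))) *
        (m * (ENNReal.ofReal (1 / 4) * Q + ENNReal.ofReal (ρ / 4 * Λ))) := by
    refine (mul_le_mul_right hsub _).trans (htel.trans ?_)
    calc _ ≤ ENNReal.ofReal (1 / μ * q) + ((m + 1 : ℕ) : ENNReal) *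
          (ENNReal.ofReal (h * (1 + 3 * (h * L)) / μ) * ENNReal.ofReal (ρ / 32 * μ * (q + Λ))
            + ENNReal.ofReal (3 * (h * L) * h) * Q) := by gcongr
      _ = ENNReal.ofReal (1 / μ * q + ((m + 1 : ℕ) : ℝ) *
          (h * (1 + 3 * (h * L)) / μ * (ρ / 32 * μ * (q + Λ)) + 3 * (h * L) * h * q)) := by
        rw [hq, ENNReal.ofReal_add (by positivity) (by positivity),
          ENNReal.ofReal_mul (p := ((m + 1 : ℕ) : ℝ)) (by positivity), ENNReal.ofReal_natCast,
          ENNReal.ofReal_add (by positivity) (by positivity),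
          ENNReal.ofReal_mul (p := h * (1 + 3 * (h * L)) / μ) (by positivity),
          ENNReal.ofReal_mul (p := 3 * (h * L) * h) (by positivity)]
      _ ≤ ENNReal.ofReal (h * (1 - 3 * (h * L)) * (m * (1 / 4 * q + ρ / 4 * Λ))) := by
        refine ENNReal.ofReal_le_ofReal ?_
        have e1 : h * (1 + 3 * (h * L)) / μ * (ρ / 32 * μ * (q + Λ)) =
            h * (1 + 3 * (h * L)) * (ρ / 32 * (q + Λ)) := by field_simp
        rw [e1, hhL]
        push_cast
        have a1 : 1 / μ * q ≤ m * h / 8 * q := by gcongr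
        have a2 : ((m : ℝ) + 1) ≤ 2 * m := by linarith
        have a3 : ρ / 32 * (q + Λ) ≤ 1 / 32 * q + ρ / 32 * Λ := by
          have : ρ * q ≤ q := by nlinarith
          linarith
        have a4 : ((m : ℝ) + 1) * (h * (1 + 3 * (1 / 512)) * (ρ / 32 * (q + Λ))
            + 3 * (1 / 512) * h * q) ≤ 2 * m * (h * (1 + 3 * (1 / 512)) *
              (1 / 32 * q + ρ / 32 * Λ) + 3 * (1 / 512) * h * q) := by gcongr
        have p1 : 0 ≤ m * h * q := by positivity
        have p2 : 0 ≤ m * h * (ρ * Λ) := by positivity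
        -- In units of `m h`, the coefficient of `q` is `1/8 + (1 + 3/512)/16 + 3/256` and that of
        -- `ρΛ` is `(1 + 3/512)/16`; both are below `(1 - 3/512)/4`.
        linarith
      _ = _ := by
        rw [hq, ENNReal.ofReal_mul hc0.le, ENNReal.ofReal_mul (p := (m : ℝ)) (by positivity),
          ENNReal.ofReal_natCast, ENNReal.ofReal_add (by positivity) (by positivity),
          ENNReal.ofReal_mul (p := 1 / 4) (by positivity)]
  rwa [ENNReal.mul_le_mul_iff_right (by simpa using hc0) ENNReal.ofReal_ne_top] at hfin

end Round

/-! ### The multi-round solver for prescribed inner lengths. -/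

section Solver

variable {d : ℕ}

/-- The reading position depends on the inner lengths only, not on the sample values; once `τ` is
fixed, each round starts at a deterministic index. -/
theorem iteratedSolver_used (D : Measure (Vec d)) (lam : ℝ) (b : Vec d) (c₂ γ : ℝ)
    (s : ℕ → Vec d) (τ : ℕ → ℕ) (i : ℕ) :
    (iteratedSolver D lam b c₂ γ s τ i).used =
      ∑ l ∈ Finset.range i, (batchSize D lam c₂ (γ / 2 ^ l) + τ l) := by
  induction i with
  | zero => rfl
  | succ i ih => rw [Finset.sum_range_succ, ← ih]; rfl

theorem iteratedSolver_succ_point (D : Measure (Vec d)) (lam : ℝ) (b : Vec d) (c₂ γ : ℝ)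
    (s : ℕ → Vec d) (τ : ℕ → ℕ) (i : ℕ) :
    (iteratedSolver D lam b c₂ γ s τ (i + 1)).point =
      ssvrgInner lam b (Sbar D lam) (c₂ / 8) (batchSize D lam c₂ (γ / 2 ^ i))
        (fun n => s (∑ l ∈ Finset.range i, (batchSize D lam c₂ (γ / 2 ^ l) + τ l) + n))
        (iteratedSolver D lam b c₂ γ s τ i).point (τ i) := by
  rw [← iteratedSolver_used D lam b c₂ γ s τ i]; rfl

theorem iteratedSolver_congr (D : Measure (Vec d)) (lam : ℝ) (b : Vec d) (c₂ γ : ℝ)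
    (s : ℕ → Vec d) {τ τ' : ℕ → ℕ} : ∀ i, (∀ l < i, τ l = τ' l) →
      iteratedSolver D lam b c₂ γ s τ i = iteratedSolver D lam b c₂ γ s τ' i
  | 0, _ => rfl
  | i + 1, h => by
    simp only [iteratedSolver]
    rw [iteratedSolver_congr D lam b c₂ γ s i fun l hl => h l (by omega), h i (by omega)]

theorem measurable_iteratedSolver_point (D : Measure (Vec d)) (lam : ℝ) (b : Vec d) (c₂ γ : ℝ)
    (τ : ℕ → ℕ) (i : ℕ) :
    Measurable fun s : ℕ → Vec d => (iteratedSolver D lam b c₂ γ s τ i).point := by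
  induction i with
  | zero => exact measurable_const
  | succ i ih =>
    simp only [iteratedSolver_succ_point]
    exact measurable_ssvrgInner _ _ _ _ _ (s := fun (s : ℕ → Vec d) n => s (_ + n))
      (fun n => measurable_pi_apply _) ih _

theorem dependsOn_iteratedSolver_point (D : Measure (Vec d)) (lam : ℝ) (b : Vec d) (c₂ γ : ℝ)
    (τ : ℕ → ℕ) (i : ℕ) :
    DependsOn (fun s : ℕ → Vec d => (iteratedSolver D lam b c₂ γ s τ i).point)
      (Set.Iio (∑ l ∈ Finset.range i, (batchSize D lam c₂ (γ / 2 ^ l) + τ l))) := by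
  induction i with
  | zero => exact fun _ _ _ => rfl
  | succ i ih =>
    intro s s' h
    simp only [iteratedSolver_succ_point]
    simp only [Finset.sum_range_succ, Set.mem_Iio] at h
    have h0 := ih fun j hj => h j (by simp only [Set.mem_Iio] at hj; omega)
    simp only at h0
    rw [h0]
    exact ssvrgInner_congr _ _ _ _ _ _ _ fun n hn => h _ (by omega)

/-- Only the first `i` inner lengths matter and they range over a countable space, so joint
measurability reduces to measurability in the stream for each fixed prefix. -/
theorem measurable_iteratedSolver_point_prod (D : Measure (Vec d)) (lam : ℝ) (b : Vec d)
    (c₂ γ : ℝ) (i : ℕ) :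
    Measurable fun w : (ℕ → ℕ) × (ℕ → Vec d) =>
      (iteratedSolver D lam b c₂ γ w.2 w.1 i).point := by
  have h : Measurable fun w : (Finset.range i → ℕ) × (ℕ → Vec d) =>
      (iteratedSolver D lam b c₂ γ w.2 (extendPrefix i w.1) i).point :=
    measurable_from_prod_countable_right fun r =>
      measurable_iteratedSolver_point D lam b c₂ γ (extendPrefix i r) i
  have h2 : Measurable fun w : (ℕ → ℕ) × (ℕ → Vec d) =>
      ((fun l : Finset.range i => w.1 l), w.2) :=
    (measurable_pi_lambda _ fun l => (measurable_pi_apply _).comp measurable_fst).prodMk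
      measurable_snd
  convert h.comp h2 using 2 with w
  simp only [Function.comp]
  rw [iteratedSolver_congr]
  intro l hl
  simp [extendPrefix, hl]

end Solver

/-! ### Averaging over the random inner lengths. -/

section Averaging

variable {d : ℕ} {D : Measure (Vec d)} [IsProbabilityMeasure D]
  {Ω : Type*} [MeasurableSpace Ω] {P : Measure Ω} [IsProbabilityMeasure P]
  {a : ℕ → Ω → Vec d} {mt : ℕ → Ω → ℕ}

theorem lintegral_energy_succ_le (h4 : Integrable (fun a => ‖a‖ ^ 4) D)
    {V lam μ Λ : ℝ} (hμ : 0 < μ) (hV0 : 0 ≤ V) (hlam : μ ≤ lam)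
    (hV : ∀ x, ∫ a, inner ℝ a x * inner ℝ a x * ‖a‖ ^ 2 ∂D ≤ V * ‖x‖ ^ 2)
    (hB : ∀ x, μ * ‖x‖ ^ 2 ≤ energy D lam x) (hL : Sbar D lam = lam + V / μ)
    {b xs : Vec d} (hb : b = lam • xs - secondMomentCLM D xs) (hxs : energy D lam xs ≤ Λ)
    (hk : ∀ i : ℕ, 0 < batchSize D lam (1 / 64) (1 / 64 / 2 ^ i) ∧
      V / (μ ^ 2 * (1 / 64 / 2 ^ i)) ≤ batchSize D lam (1 / 64) (1 / 64 / 2 ^ i))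
    (hm0 : 1 ≤ innerLength D lam (1 / 64))
    (hm : Sbar D lam / (μ * (1 / 64) ^ 2) ≤ innerLength D lam (1 / 64))
    (ha : ∀ n, Measurable (a n)) (hD : ∀ n, P.map (a n) = D) (hind : iIndepFun a P)
    (hmt : ∀ i, Measurable (mt i))
    (hU : ∀ i, P.map (mt i) = uniformOn (Set.Icc 1 (innerLength D lam (1 / 64))))
    (hmtind : iIndepFun mt P)
    (hI : IndepFun (fun ω n => a n ω) (fun ω i => mt i ω) P) (i : ℕ) :
    ∫⁻ ω, ENNReal.ofReal (energy D lam ((iteratedSolver D lam b (1 / 64) (1 / 64)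
        (fun n => a n ω) (fun i => mt i ω) (i + 1)).point - xs)) ∂P ≤
      ENNReal.ofReal (1 / 4) * ∫⁻ ω, ENNReal.ofReal (energy D lam ((iteratedSolver D lam b
        (1 / 64) (1 / 64) (fun n => a n ω) (fun i => mt i ω) i).point - xs)) ∂P
      + ENNReal.ofReal (1 / 2 ^ i / 4 * Λ) := by
  set m := innerLength D lam (1 / 64)
  have hs : Measurable fun ω n => a n ω := measurable_pi_lambda _ ha
  have hτ : Measurable fun ω i => mt i ω := measurable_pi_lambda _ hmt
  -- Expected energy over the stream with all inner lengths frozen at `τ`; `hG` recovers the true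
  -- expectation by independence of stream and lengths.
  let G : ℕ → (ℕ → ℕ) → ENNReal := fun i τ => ∫⁻ ω, ENNReal.ofReal (energy D lam
    ((iteratedSolver D lam b (1 / 64) (1 / 64) (fun n => a n ω) τ i).point - xs)) ∂P
  have hG : ∀ i, ∫⁻ ω, ENNReal.ofReal (energy D lam ((iteratedSolver D lam b (1 / 64) (1 / 64)
      (fun n => a n ω) (fun i => mt i ω) i).point - xs)) ∂P = ∫⁻ ω, G i (fun i => mt i ω) ∂P := by
    intro i
    have hf : Measurable fun w : (ℕ → ℕ) × (ℕ → Vec d) => ENNReal.ofReal (energy D lam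
        ((iteratedSolver D lam b (1 / 64) (1 / 64) w.2 w.1 i).point - xs)) :=
      (measurable_energy D lam
        ((measurable_iteratedSolver_point_prod D lam b _ _ i).sub_const xs)).ennreal_ofReal
    rw [lintegral_of_indepFun hτ hs hI.symm hf]
    refine lintegral_congr fun ω => ?_
    exact lintegral_map (hf.comp measurable_prodMk_left) hs
  -- The length `j` of round `i` is separated from the earlier lengths `τ`, so that `j` can be
  -- averaged uniformly with the past held fixed.
  let H : (ℕ → ℕ) → ℕ → ENNReal := fun τ j => ∫⁻ ω, ENNReal.ofReal (energy D lam
    (ssvrgInner lam b (Sbar D lam) (1 / 64 / 8) (batchSize D lam (1 / 64) (1 / 64 / 2 ^ i))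
        (fun n => a (∑ l ∈ Finset.range i, (batchSize D lam (1 / 64) (1 / 64 / 2 ^ l) + τ l) + n) ω)
        (iteratedSolver D lam b (1 / 64) (1 / 64) (fun n => a n ω) τ i).point j - xs)) ∂P
  have hGH : ∀ τ, G (i + 1) τ = H τ (τ i) := fun τ =>
    lintegral_congr fun ω => by rw [iteratedSolver_succ_point]
  have hHd : DependsOn H (Set.Iio i) := by
    intro τ τ' h
    ext j
    simp only [H]
    have e1 : ∑ l ∈ Finset.range i, (batchSize D lam (1 / 64) (1 / 64 / 2 ^ l) + τ l) =
        ∑ l ∈ Finset.range i, (batchSize D lam (1 / 64) (1 / 64 / 2 ^ l) + τ' l) :=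
      Finset.sum_congr rfl fun l hl => by rw [h l (by simpa using hl)]
    rw [e1]
    refine lintegral_congr fun ω => ?_
    rw [iteratedSolver_congr D lam b _ _ _ i h]
  have hHm : Measurable H := measurable_of_dependsOn_nat hHd
  have hround : ∀ τ, ∑ j ∈ Finset.Icc 1 m, H τ j ≤
      m * (ENNReal.ofReal (1 / 4) * G i τ + ENNReal.ofReal (1 / 2 ^ i / 4 * Λ)) := by
    intro τ
    refine sum_lintegral_energy_round_le h4 hμ hV0 hlam hV hB hL hb hxs (ρ := 1 / 2 ^ i)
      (by positivity) ?_ ha hD hind (measurable_iteratedSolver_point D lam b _ _ τ i)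
      (dependsOn_iteratedSolver_point D lam b _ _ τ i) (hk i).1 ?_ hm0 hm
    · rw [div_le_one (by positivity)]; exact one_le_pow₀ (by norm_num)
    · rw [mul_one_div]; exact (hk i).2
  have hf : Measurable fun w : (ℕ → ENNReal) × ℕ => w.1 w.2 :=
    measurable_from_prod_countable_left fun j => measurable_pi_apply j
  have hm1 : (m : ENNReal) ≠ 0 := by simp; omega
  calc _ = ∫⁻ ω, H (fun l => mt l ω) (mt i ω) ∂P := by
        rw [hG]; exact lintegral_congr fun ω => hGH _
    _ = ∫⁻ ω, ∫⁻ j, H (fun l => mt l ω) j ∂(P.map (mt i)) ∂P :=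
        lintegral_prefix_next hmt hmtind hHm hHd hf
    _ ≤ ∫⁻ ω, (ENNReal.ofReal (1 / 4) * G i (fun l => mt l ω)
          + ENNReal.ofReal (1 / 2 ^ i / 4 * Λ)) ∂P := by
        refine lintegral_mono fun ω => ?_
        rw [hU, lintegral_uniformOn_Icc]
        refine (mul_le_mul_right (hround _) _).trans (le_of_eq ?_)
        rw [← mul_assoc, ENNReal.inv_mul_cancel hm1 (by simp), one_mul]
    _ = _ := by
        rw [lintegral_add_right _ measurable_const, lintegral_const_mul' _ _ (by simp), hG i]
        simp

theorem lintegral_energy_le (h4 : Integrable (fun a => ‖a‖ ^ 4) D)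
    {V lam μ Λ : ℝ} (hμ : 0 < μ) (hV0 : 0 ≤ V) (hlam : μ ≤ lam)
    (hV : ∀ x, ∫ a, inner ℝ a x * inner ℝ a x * ‖a‖ ^ 2 ∂D ≤ V * ‖x‖ ^ 2)
    (hB : ∀ x, μ * ‖x‖ ^ 2 ≤ energy D lam x) (hL : Sbar D lam = lam + V / μ)
    {b xs : Vec d} (hb : b = lam • xs - secondMomentCLM D xs) (hxs : energy D lam xs ≤ Λ)
    (hk : ∀ i : ℕ, 0 < batchSize D lam (1 / 64) (1 / 64 / 2 ^ i) ∧
      V / (μ ^ 2 * (1 / 64 / 2 ^ i)) ≤ batchSize D lam (1 / 64) (1 / 64 / 2 ^ i))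
    (hm0 : 1 ≤ innerLength D lam (1 / 64))
    (hm : Sbar D lam / (μ * (1 / 64) ^ 2) ≤ innerLength D lam (1 / 64))
    (ha : ∀ n, Measurable (a n)) (hD : ∀ n, P.map (a n) = D) (hind : iIndepFun a P)
    (hmt : ∀ i, Measurable (mt i))
    (hU : ∀ i, P.map (mt i) = uniformOn (Set.Icc 1 (innerLength D lam (1 / 64))))
    (hmtind : iIndepFun mt P)
    (hI : IndepFun (fun ω n => a n ω) (fun ω i => mt i ω) P) (i : ℕ) :
    ∫⁻ ω, ENNReal.ofReal (energy D lam ((iteratedSolver D lam b (1 / 64) (1 / 64)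
        (fun n => a n ω) (fun i => mt i ω) i).point - xs)) ∂P ≤
      ENNReal.ofReal (1 / 2 ^ i * Λ) := by
  have hΛ : 0 ≤ Λ := (by positivity : 0 ≤ μ * ‖xs‖ ^ 2).trans ((hB xs).trans hxs)
  induction i with
  | zero =>
    have : energy D lam (-xs) = energy D lam xs := by simp [energy]
    simpa [iteratedSolver, this] using ENNReal.ofReal_le_ofReal hxs
  | succ i ih =>
    refine (lintegral_energy_succ_le h4 hμ hV0 hlam hV hB hL hb hxs hk hm0 hm ha hD hind hmt hU
      hmtind hI i).trans ((add_le_add_left (mul_le_mul_right ih _) _).trans ?_)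
    rw [← ENNReal.ofReal_mul (by norm_num), ← ENNReal.ofReal_add (by positivity) (by positivity)]
    refine ENNReal.ofReal_le_ofReal (le_of_eq ?_)
    -- The contracted error and the batch floor each contribute `2^{-i}Λ/4`, adding up to
    -- `2^{-(i+1)}Λ`.
    rw [pow_succ]; field_simp; ring

end Averaging

/-! ### Positivity of `B` and bounds on the problem parameters. -/

section Parameters

variable {d : ℕ} {D : Measure (Vec d)}

theorem toEuclideanCLM_shifted (D : Measure (Vec d)) (lam : ℝ) (x : Vec d) :
    toEuclideanCLM (n := Fin d) (𝕜 := ℝ) (shifted D lam) x = lam • x - secondMomentCLM D x := by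
  simp [shifted, secondMomentCLM]

theorem inner_shifted (D : Measure (Vec d)) (lam : ℝ) (x : Vec d) :
    inner ℝ x (toEuclideanCLM (n := Fin d) (𝕜 := ℝ) (shifted D lam) x) = energy D lam x := by
  rw [toEuclideanCLM_shifted, inner_sub_right, real_inner_smul_right, real_inner_self_eq_norm_sq,
    energy]

theorem matNorm_shifted_sq {lam : ℝ} {x : Vec d} (h : 0 ≤ energy D lam x) :
    matNorm (shifted D lam) x ^ 2 = energy D lam x := by
  rw [matNorm, ← inner_toEuclideanCLM, inner_shifted, Real.sq_sqrt h]

theorem isUnit_det_shifted {lam μ : ℝ} (hμ : 0 < μ)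
    (hB : ∀ x, μ * ‖x‖ ^ 2 ≤ energy D lam x) : IsUnit (shifted D lam).det := by
  rw [← isUnit_iff_isUnit_det, ← mulVec_injective_iff_isUnit]
  intro v w hvw
  have h : toEuclideanCLM (n := Fin d) (𝕜 := ℝ) (shifted D lam) (WithLp.toLp 2 (v - w)) = 0 := by
    rw [toEuclideanCLM_toLp, mulVec_sub, hvw, sub_self]; rfl
  have h2 := hB (WithLp.toLp 2 (v - w))
  rw [← inner_shifted, h, inner_zero_right] at h2
  have h3 : ‖(WithLp.toLp 2 (v - w) : Vec d)‖ = 0 := by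
    have : ‖(WithLp.toLp 2 (v - w) : Vec d)‖ ^ 2 = 0 :=
      le_antisymm (nonpos_of_mul_nonpos_right h2 hμ) (sq_nonneg _)
    simpa using this
  have h4 : (WithLp.toLp 2 (v - w) : Vec d) = WithLp.toLp 2 0 := by simpa using h3
  exact sub_eq_zero.1 (WithLp.toLp_injective 2 h4)

theorem shifted_solution {lam : ℝ} (hdet : IsUnit (shifted D lam).det) (b : Vec d) :
    toEuclideanCLM (n := Fin d) (𝕜 := ℝ) (shifted D lam) (solution D lam b) = b := by
  rw [solution, toEuclideanCLM_toLp, mulVec_mulVec, mul_nonsing_inv _ hdet, one_mulVec]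

/-- Because `x*ᵀBx* = bᵀB⁻¹b` with `b` a unit vector. This lets the algorithm start at `0` without
an initial error hypothesis. -/
theorem energy_solution_le {lam : ℝ} (hdet : IsUnit (shifted D lam).det) (hd : 1 ≤ d) {b : Vec d}
    (hb : ‖b‖ = 1) : energy D lam (solution D lam b) ≤ eigenvalue (shifted D lam)⁻¹ 1 := by
  have h := quadForm_le_eigenvalue_one (shifted_inv_isHermitian D lam) hd b
  rw [hb, one_pow, mul_one] at h
  have h2 : toEuclideanCLM (n := Fin d) (𝕜 := ℝ) (shifted D lam)⁻¹ b = solution D lam b := by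
    rw [solution, ← toEuclideanCLM_toLp]
  rwa [← inner_shifted, shifted_solution hdet, real_inner_comm, ← h2]

theorem mul_norm_sq_le_energy (hd : 1 ≤ d) (lam : ℝ) (x : Vec d) :
    mu D lam * ‖x‖ ^ 2 ≤ energy D lam x := by
  have := quadForm_le_eigenvalue_one (secondMoment_isHermitian D) hd x
  rw [energy, mu, sub_mul]
  exact sub_le_sub_left this _

variable [IsProbabilityMeasure D]

theorem specNorm_secondMoment (h4 : Integrable (fun a => ‖a‖ ^ 4) D) (hd : 1 ≤ d) :
    specNorm (secondMoment D) = topEig D :=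
  specNorm_eq_eigenvalue_one (secondMoment_isHermitian D) hd (secondMomentCLM_nonneg h4)

theorem topEig_pos_and_gap_le_one (h4 : Integrable (fun a => ‖a‖ ^ 4) D) (hd : 2 ≤ d)
    (hgap : 0 < gap D) : 0 < topEig D ∧ gap D ≤ 1 := by
  have h1 : 0 ≤ topEig D := eigenvalue_nonneg (secondMoment_isHermitian D)
    (secondMomentCLM_nonneg h4) le_rfl (by omega)
  have h2 : 0 ≤ eigenvalue (secondMoment D) 2 := eigenvalue_nonneg (secondMoment_isHermitian D)
    (secondMomentCLM_nonneg h4) (by omega) hd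
  have h0 : 0 < topEig D := by
    refine h1.lt_of_ne fun h => hgap.ne' ?_
    rw [gap, ← topEig, ← h, div_zero]
  refine ⟨h0, ?_⟩
  rw [gap, ← topEig, div_le_one h0]
  linarith

/-- Jensen's inequality at a top eigenvector of `Σ`. It yields `v(D) ≥ 1`, which absorbs the
lower-order terms of the sample count. -/
theorem topEig_sq_le_specNorm_fourthMoment (h4 : Integrable (fun a => ‖a‖ ^ 4) D) (hd : 1 ≤ d) :
    topEig D ^ 2 ≤ specNorm (fourthMoment D) := by
  obtain ⟨u, hu, hTu⟩ := exists_unit_eigenvector (secondMoment_isHermitian D) le_rfl hd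
  have h := (norm_secondMomentCLM_sq_le h4 u).trans (integral_inner_sq_mul_norm_sq_le h4 u)
  rw [secondMomentCLM, hTu, norm_smul, hu, mul_one, one_pow, mul_one, Real.norm_eq_abs,
    sq_abs] at h
  exact h

end Parameters

/-! ### Sample complexity. -/

section SampleCount

/-- Everything follows from `T/μ ≤ 150/g`: `22500 = 150²`, and `152` exceeds `150 · 1.01`. The
dominant term is `4096 · 22652`, from the inner length; the rounding errors are absorbed by `v/g² ≥
1`. -/
theorem round_samples_le {g T μ lam v S : ℝ} (hg : 0 < g) (hg1 : g ≤ 1) (hT : 0 < T)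
    (hμ : g * T / 150 ≤ μ) (hlam : lam ≤ (1 + g / 100) * T) (hv : 1 ≤ v)
    (hS : S = lam + v * T ^ 2 / μ) (hS0 : 0 ≤ S) (i : ℕ) :
    ((max ⌈S / (μ * (1 / 64))⌉₊ ⌈v * T ^ 2 / (μ ^ 2 * (1 / 64 / 2 ^ i))⌉₊ : ℕ) : ℝ)
      + (⌈S / (μ * (1 / 64) ^ 2)⌉₊ : ℝ) ≤ 100000000 * (v / g ^ 2) * 2 ^ i := by
  have hμ0 : 0 < μ := lt_of_lt_of_le (by positivity) hμ
  have hX : 1 ≤ v / g ^ 2 := by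
    rw [le_div_iff₀ (by positivity)]; nlinarith
  have hTμ : T / μ ≤ 150 / g := by
    rw [div_le_div_iff₀ hμ0 hg]; linarith
  have h1 : v * T ^ 2 / μ ^ 2 ≤ 22500 * (v / g ^ 2) := by
    calc v * T ^ 2 / μ ^ 2 = v * (T / μ) ^ 2 := by rw [div_pow]; ring
      _ ≤ v * (150 / g) ^ 2 := by gcongr
      _ = _ := by rw [div_pow]; ring
  have h2 : lam / μ ≤ 152 * (v / g ^ 2) := by
    calc lam / μ ≤ (1 + g / 100) * T / μ := by gcongr
      _ = (1 + g / 100) * (T / μ) := by ring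
      _ ≤ (1 + 1 / 100) * (150 / g) := by gcongr
      _ ≤ 152 * (1 / g) := by
        have : 0 < 1 / g := by positivity
        have e : 150 / g = 150 * (1 / g) := by ring
        rw [e]; linarith
      _ ≤ 152 * (v / g ^ 2) := by
        gcongr ?_ * ?_
        rw [div_le_div_iff₀ hg (by positivity)]
        nlinarith
  have h3 : S / μ ≤ 22652 * (v / g ^ 2) := by
    have : S / μ = lam / μ + v * T ^ 2 / μ ^ 2 := by rw [hS]; field_simp
    linarith
  have hp : (1 : ℝ) ≤ 2 ^ i := one_le_pow₀ (by norm_num)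
  have hXp : v / g ^ 2 ≤ v / g ^ 2 * 2 ^ i := le_mul_of_one_le_right (by linarith) hp
  have c1 := Nat.ceil_lt_add_one (a := S / (μ * (1 / 64))) (by positivity)
  have c2 := Nat.ceil_lt_add_one (a := v * T ^ 2 / (μ ^ 2 * (1 / 64 / 2 ^ i))) (by positivity)
  have c3 := Nat.ceil_lt_add_one (a := S / (μ * (1 / 64) ^ 2)) (by positivity)
  have e1 : S / (μ * (1 / 64)) = 64 * (S / μ) := by field_simp
  have e2 : v * T ^ 2 / (μ ^ 2 * (1 / 64 / 2 ^ i)) = 64 * (v * T ^ 2 / μ ^ 2) * 2 ^ i := by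
    field_simp
  have e3 : S / (μ * (1 / 64) ^ 2) = 4096 * (S / μ) := by field_simp; norm_num
  have h4 : 64 * (v * T ^ 2 / μ ^ 2) * 2 ^ i ≤ 64 * (22500 * (v / g ^ 2)) * 2 ^ i := by gcongr
  rw [e1] at c1
  rw [e2] at c2
  rw [e3] at c3
  rw [e1, e2, e3, Nat.cast_max]
  have := max_le_add_of_nonneg (Nat.cast_nonneg (α := ℝ) ⌈64 * (S / μ)⌉₊)
    (Nat.cast_nonneg (α := ℝ) ⌈64 * (v * T ^ 2 / μ ^ 2) * 2 ^ i⌉₊)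
  linarith

theorem two_pow_ceil_logb {c : ℝ} (h0 : 0 < c) (h1 : c < 1) :
    1 / 2 ^ ⌈Real.logb 2 (1 / c)⌉₊ ≤ c ∧ (2 : ℝ) ^ ⌈Real.logb 2 (1 / c)⌉₊ ≤ 2 / c := by
  have hc : 1 < 1 / c := by rw [lt_div_iff₀ h0]; linarith
  have hl : (2 : ℝ) ^ Real.logb 2 (1 / c) = 1 / c :=
    Real.rpow_logb (by norm_num) (by norm_num) (by positivity)
  constructor
  · rw [div_le_comm₀ (by positivity) h0, ← Real.rpow_natCast]
    refine hl.symm.trans_le ?_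
    exact Real.rpow_le_rpow_of_exponent_le (by norm_num) (Nat.le_ceil _)
  · rw [← Real.rpow_natCast]
    calc _ ≤ (2 : ℝ) ^ (Real.logb 2 (1 / c) + 1) :=
          Real.rpow_le_rpow_of_exponent_le (by norm_num)
            (Nat.ceil_lt_add_one (Real.logb_nonneg (by norm_num) hc.le)).le
      _ = _ := by rw [Real.rpow_add_one (by norm_num), hl]; ring

end SampleCount

end StreamingSVRG

open StreamingSVRG

theorem mainTheorem10 :
    ∃ c₂ γ C : ℝ, 0 < c₂ ∧ c₂ < 1 ∧ 0 < γ ∧ γ < 1 ∧ 0 < C ∧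
      ∀ (d : ℕ) (_ : 2 ≤ d)
        (D : Measure (StreamingSVRG.Vec d)) (_ : IsProbabilityMeasure D)
        (_ : Integrable (fun a => ‖a‖ ^ 4) D)
        (_ : 0 < StreamingSVRG.gap D)
        (lam : ℝ)
        (_ : (1 + StreamingSVRG.gap D / 150) * StreamingSVRG.topEig D ≤ lam)
        (_ : lam ≤ (1 + StreamingSVRG.gap D / 100) * StreamingSVRG.topEig D)
        (b : StreamingSVRG.Vec d) (_ : ‖b‖ = 1)
        (c₃ : ℝ) (_ : 0 < c₃) (_ : c₃ < 1)
        (Ω : Type*) (_ : MeasurableSpace Ω) (P : Measure Ω) (_ : IsProbabilityMeasure P)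
        -- the stream: independent samples from `D`
        (a : ℕ → Ω → StreamingSVRG.Vec d)
        (_ : ∀ n, Measurable (a n)) (_ : ∀ n, P.map (a n) = D) (_ : iIndepFun a P)
        -- the random numbers of inner iterations: independent, uniform on `{1, …, m}`,
        -- and independent of the stream
        (mt : ℕ → Ω → ℕ)
        (_ : ∀ i, Measurable (mt i))
        (_ : ∀ i, P.map (mt i) =
          uniformOn (Set.Icc 1 (StreamingSVRG.innerLength D lam c₂)))
        (_ : iIndepFun mt P)
        (_ : IndepFun (fun ω n => a n ω) (fun ω i => mt i ω) P),
        let out : Ω → StreamingSVRG.State d := fun ω =>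
          StreamingSVRG.iteratedSolver D lam b c₂ γ (fun n => a n ω) (fun i => mt i ω)
            ⌈Real.logb 2 (1 / c₃)⌉₊
        let err : Ω → ℝ := fun ω =>
          StreamingSVRG.matNorm (StreamingSVRG.shifted D lam)
            ((out ω).point - StreamingSVRG.solution D lam b) ^ 2
        (Integrable err P ∧
          ∫ ω, err ω ∂P ≤
            10 * c₃ * StreamingSVRG.eigenvalue (StreamingSVRG.shifted D lam)⁻¹ 1) ∧
        (∀ᵐ ω ∂P, ((out ω).used : ℝ) ≤
          C * (StreamingSVRG.nvar D / (StreamingSVRG.gap D ^ 2 * c₃))) := by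
  -- The last constant is the per-round `10⁸` times the `2` in `2^N ≤ 2/c₃`.
  refine ⟨1 / 64, 1 / 64, 200000000, by norm_num, by norm_num, by norm_num, by norm_num,
    by norm_num, ?_⟩
  intro d hd D _ h4 hgap lam hlam1 hlam2 b hb c₃ hc0 hc1 Ω _ P _ a ha hD hind mt hmt hU hmtind hI
    out err
  have hd1 : 1 ≤ d := by omega
  obtain ⟨hT, hg1⟩ := topEig_pos_and_gap_le_one h4 hd hgap
  have hspec := specNorm_secondMoment h4 hd1
  have hTF := topEig_sq_le_specNorm_fourthMoment h4 hd1
  have hV : nvar D * topEig D ^ 2 = specNorm (fourthMoment D) := by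
    rw [nvar, hspec]; field_simp
  have hv : 1 ≤ nvar D := by rwa [nvar, hspec, one_le_div (by positivity)]
  have hV0 : 0 < specNorm (fourthMoment D) := lt_of_lt_of_le (by positivity) hTF
  have hμ : gap D * topEig D / 150 ≤ mu D lam := by rw [mu]; linarith
  have hμ0 : 0 < mu D lam := lt_of_lt_of_le (by positivity) hμ
  have hlamμ : mu D lam ≤ lam := by rw [mu]; linarith
  have hB := mul_norm_sq_le_energy (D := D) hd1 lam
  have hE : ∀ x, 0 ≤ energy D lam x := fun x => (by positivity : 0 ≤ mu D lam * ‖x‖ ^ 2).trans (hB x)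
  have hL : Sbar D lam = lam + specNorm (fourthMoment D) / mu D lam := by rw [Sbar, hV]
  have hS0 : 0 < Sbar D lam := by rw [hL]; have := hμ0.trans_le hlamμ; positivity
  have hdet := isUnit_det_shifted hμ0 hB
  have hbs : b = lam • solution D lam b - secondMomentCLM D (solution D lam b) := by
    rw [← toEuclideanCLM_shifted, shifted_solution hdet]
  have hxs := energy_solution_le hdet hd1 hb
  have hk : ∀ i : ℕ, 0 < batchSize D lam (1 / 64) (1 / 64 / 2 ^ i) ∧
      specNorm (fourthMoment D) / (mu D lam ^ 2 * (1 / 64 / 2 ^ i)) ≤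
        batchSize D lam (1 / 64) (1 / 64 / 2 ^ i) := fun i => by
    rw [batchSize, hV]
    refine ⟨lt_max_of_lt_right (Nat.ceil_pos.2 (by positivity)), ?_⟩
    exact (Nat.le_ceil _).trans (Nat.cast_le.2 (le_max_right _ _))
  have hm0 : 1 ≤ innerLength D lam (1 / 64) := Nat.ceil_pos.2 (by positivity)
  obtain ⟨hN1, hN2⟩ := two_pow_ceil_logb hc0 hc1
  set N := ⌈Real.logb 2 (1 / c₃)⌉₊
  have hΛ := (hE _).trans hxs
  have herr : ∀ ω, err ω = energy D lam ((out ω).point - solution D lam b) :=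
    fun ω => matNorm_shifted_sq (hE _)
  have herr0 : ∀ ω, 0 ≤ err ω := fun ω => sq_nonneg _
  have hmeas : Measurable err := by
    rw [funext herr]
    refine measurable_energy D lam (Measurable.sub_const ?_ _)
    exact (measurable_iteratedSolver_point_prod D lam b (1 / 64) (1 / 64) N).comp
      ((measurable_pi_lambda (fun ω i => mt i ω) hmt).prodMk
        (measurable_pi_lambda (fun ω i => a i ω) ha))
  have hmain : ∫⁻ ω, ENNReal.ofReal (err ω) ∂P ≤
      ENNReal.ofReal (1 / 2 ^ N * eigenvalue (shifted D lam)⁻¹ 1) := by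
    simp only [herr]
    exact lintegral_energy_le h4 hμ0 hV0.le hlamμ (integral_inner_sq_mul_norm_sq_le h4) hB hL hbs
      hxs hk hm0 (Nat.le_ceil _) ha hD hind hmt hU hmtind hI N
  refine ⟨⟨⟨hmeas.aestronglyMeasurable, ?_⟩, ?_⟩, ?_⟩
  · rw [hasFiniteIntegral_iff_ofReal (ae_of_all _ herr0)]
    exact hmain.trans_lt ENNReal.ofReal_lt_top
  · rw [integral_eq_lintegral_of_nonneg_ae (ae_of_all _ herr0) hmeas.aestronglyMeasurable]
    refine ENNReal.toReal_le_of_le_ofReal (by positivity) (hmain.trans ?_)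
    refine ENNReal.ofReal_le_ofReal (mul_le_mul_of_nonneg_right ?_ hΛ)
    -- The argument gives the factor `1` in place of `10`, since `2^{-N} ≤ c₃`.
    linarith
  -- The sample bound is only almost sure because `mt i ≤ m` is known only through the law of `mt
  -- i`.
  · have hae : ∀ᵐ ω ∂P, ∀ i, mt i ω ≤ innerLength D lam (1 / 64) := by
      rw [ae_all_iff]
      intro i
      refine ae_of_ae_map (hmt i).aemeasurable (p := fun j => j ≤ innerLength D lam (1 / 64)) ?_
      rw [hU i, uniformOn]
      filter_upwards [ae_cond_mem (measurableSet_Icc (a := 1) (b := innerLength D lam (1 / 64)))]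
        with j hj using hj.2
    filter_upwards [hae] with ω hω
    have hsum : ((out ω).used : ℝ) = ∑ l ∈ Finset.range N,
        ((batchSize D lam (1 / 64) (1 / 64 / 2 ^ l) : ℝ) + (mt l ω : ℝ)) := by
      simp only [out, iteratedSolver_used]
      push_cast
      rfl
    have hX : 0 ≤ 100000000 * (nvar D / gap D ^ 2) := by positivity
    calc ((out ω).used : ℝ) ≤ ∑ l ∈ Finset.range N, 100000000 * (nvar D / gap D ^ 2) * 2 ^ l := by
          rw [hsum]
          refine Finset.sum_le_sum fun l _ => le_trans ?_
            (round_samples_le hgap hg1 hT hμ hlam2 hv rfl hS0.le l)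
          exact add_le_add_right (Nat.cast_le.2 (hω l)) _
      _ = 100000000 * (nvar D / gap D ^ 2) * (2 ^ N - 1) := by
          rw [← Finset.mul_sum, geom_sum_eq (by norm_num)]; norm_num
      _ ≤ 100000000 * (nvar D / gap D ^ 2) * (2 / c₃) := by gcongr; linarith
      _ = _ := by field_simp; norm_num
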